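/- **Setting.** Let $M\subset\mathbb R^n$ be a bounded Lipschitz domain with a Riemannian metric $g$ that is smooth up to the boundary, let $\Gamma_1,\Gamma_2$ be disjoint relatively open subsets of $\partial M$ with $\overline\Gamma_1\cup\overline\Gamma_2=\partial M$, and let $\mathcal T_h$ be a finite decomposition of $M$ into disjoint Lipschitz elements $T$ covering $M$ up to a null set. Let $H\Omega^k(U)$ be the space of $\omega\in L^2\Omega^k(U)$ with $\mathrm d\omega\in L^2\Omega^{k+1}(U)$ in the sense of distributions, $\mathring H\Omega^k(U)$ the closure in it of the smooth forms with compact support in $U$, and $H\Omega^k(M,\Gamma)$ the closure in $H\Omega^k(M)$ of the restrictions of smooth compactly supported forms on $\mathbb R^n$ whose support does not meet $\overline\Gamma$ (the forms with $\operatorname{tr}\omega|_\Gamma=0$). Tangential traces on $\partial T$ and on $\Gamma$ are the classes in $H\Omega^k(T)/\mathring H\Omega^k(T)$ and $H\Omega^k(M)/H\Omega^k(M,\Gamma)$. Write $(\cdot,\cdot)_{\mathcal T_h}=\sum_T(\cdot,\cdot)_T$ for the $L^2$ inner product of forms induced by $g$; it is the $L^2$ inner product on $M$. For $v\in H\Omega^k(M)$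 with $\operatorname{tr}v=0$ on $\Gamma_{3-i}$ and $u=\operatorname{tr}w|_{\Gamma_i}$, $w\in H\Omega^{n-k-1}(M)$, let $\langle \operatorname{tr}v\,|\,u\rangle_{\Gamma_i}=\int_{\Gamma_i}\operatorname{tr} v\wedge u:=\int_M \mathrm dv\wedge w+(-1)^k v\wedge \mathrm dw$. For each $T$ let $W_h^k(T)\subset H\Omega^k(T)$ be a finite dimensional subcomplex (for inner oriented forms), and put $W_h^k=\prod_T W_h^k(T)$, $V_h^k=H\Omega^k(M)\cap W_h^k$, $V_h^k(\Gamma)=\{v\in V_h^k:\operatorname{tr}v|_\Gamma=0\}$. On $\partial\mathcal T_h=\bigsqcup_T\partial T$ put $W_h^{k,t}=\operatorname{tr}W_h^k$, $V_h^{k,t}=\operatorname{tr}V_h^k$, $V_h^{k,t}(\Gamma)=\operatorname{tr}V_h^k(\Gamma)$ and $W_h^{k,n}=(W_h^{k,t})^*$, and let $\langle\cdot,\cdot\rangle_{\partial\mathcal T_h}$ be the duality pairing of $W_h^{k,t}$ and $W_h^{k,n}$. Hats denote the analogous spaces for outer oriented forms, built from a second family $\hat W_h^k(T)$. Let $p,q\ge1$,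 $p+q=n+1$, $T_{\rm end}>0$, and let the inputs $u_1(t)\in \operatorname{tr}V_h^{q-1}|_{\Gamma_1}$, $\hat u_2(t)\in\operatorname{tr}\hat V_h^{p-1}|_{\Gamma_2}$ be given. All equations are required for every $t\in(0,T_{\rm end}]$, and the variables that are differentiated in time are differentiable on $(0,T_{\rm end}]$. *Mixed primal problem.* $\hat\alpha\in\hat W_h^p$, $\hat\beta\in\hat V_h^{p-1}$, $(-1)^p\operatorname{tr}\hat\beta|_{\Gamma_2}=\hat u_2$, $$(v,\partial_t\hat\alpha)_M=(-1)^p(v,\mathrm d\hat\beta)_M\ \ \forall v\in\hat W_h^p,\qquad (v,\partial_t\hat\beta)_M=(-1)^p\{-(\mathrm dv,\hat\alpha)_M+\langle\operatorname{tr}v\,|\,u_1\rangle_{\Gamma_1}\}\ \ \forall v\in\hat V_h^{p-1}(\Gamma_2).$$ *Hybrid primal problem.* $\hat\alpha\in\hat W_h^p$, $\hat\beta\in\hat W_h^{p-1}$, $\hat\alpha^{n}\in\hat W_h^{p-1,n}$, $\hat\beta^{t}\in\hat V_h^{p-1,t}$, $(-1)^p\hat\beta^t|_{\Gamma_2}=\hat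 u_2$, \begin{align*} (v,\partial_t\hat\alpha)_{\mathcal T_h}&=(-1)^p(v,\mathrm d\hat\beta)_{\mathcal T_h}&&\forall v\in\hat W_h^p,\\ (v,\partial_t\hat\beta)_{\mathcal T_h}&=(-1)^p\{-(\mathrm dv,\hat\alpha)_{\mathcal T_h}+\langle\operatorname{tr}v,\hat\alpha^n\rangle_{\partial\mathcal T_h}\}&&\forall v\in\hat W_h^{p-1},\tag{P}\\ 0&=-(-1)^p\langle v^n,\operatorname{tr}\hat\beta-\hat\beta^t\rangle_{\partial\mathcal T_h}&&\forall v^n\in\hat W_h^{p-1,n},\\ 0&=(-1)^p\{-\langle v^t,\hat\alpha^n\rangle_{\partial\mathcal T_h}+\langle v^t\,|\,u_1\rangle_{\Gamma_1}\}&&\forall v^t\in\hat V_h^{p-1,t}(\Gamma_2). \end{align*} *Mixed dual problem.* $\alpha\in V_h^{q-1}$, $\beta\in W_h^q$, $\operatorname{tr}\alpha|_{\Gamma_1}=u_1$, $$(v,\partial_t\alpha)_M=(\mathrm dv,\beta)_M+(-1)^{(p-1)(q-1)}\langle\operatorname{tr}v\,|\,\hat u_2\rangle_{\Gamma_2}\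 \ \forall v\in V_h^{q-1}(\Gamma_1),\qquad (v,\partial_t\beta)_M=-(v,\mathrm d\alpha)_M\ \ \forall v\in W_h^q.$$ *Hybrid dual problem.* $\alpha\in W_h^{q-1}$, $\beta\in W_h^q$, $\beta^n\in W_h^{q-1,n}$, $\alpha^t\in V_h^{q-1,t}$, $\alpha^t|_{\Gamma_1}=u_1$, \begin{align*} (v,\partial_t\alpha)_{\mathcal T_h}&=(\mathrm dv,\beta)_{\mathcal T_h}-\langle\operatorname{tr}v,\beta^n\rangle_{\partial\mathcal T_h}&&\forall v\in W_h^{q-1},\tag{D}\\ (v,\partial_t\beta)_{\mathcal T_h}&=-(v,\mathrm d\alpha)_{\mathcal T_h}&&\forall v\in W_h^q,\\ 0&=\langle v^n,\operatorname{tr}\alpha-\alpha^t\rangle_{\partial\mathcal T_h}&&\forall v^n\in W_h^{q-1,n},\\ 0&=\langle v^t,\beta^n\rangle_{\partial\mathcal T_h}+(-1)^{(p-1)(q-1)}\langle v^t\,|\,\hat u_2\rangle_{\Gamma_2}&&\forall v^t\in V_h^{q-1,t}(\Gamma_1). \end{align*} **Theorem.** (i) $(\hat\alpha,\hat\beta,\hat\alpha^n,\hat\beta^t)$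 solves the hybrid primal problem if and only if $\hat\beta$ is $\hat V_h^{p-1}$-valued, $(\hat\alpha,\hat\beta)$ solves the mixed primal problem, $\hat\beta^t=\operatorname{tr}\hat\beta$ on $\partial\mathcal T_h$, and $\hat\alpha^n$ satisfies (P). Moreover, for every solution $(\hat\alpha,\hat\beta)$ of the mixed primal problem and every $t\in(0,T_{\rm end}]$ there is exactly one $\hat\alpha^n(t)\in\hat W_h^{p-1,n}$ that satisfies (P). (ii) $(\alpha,\beta,\beta^n,\alpha^t)$ solves the hybrid dual problem if and only if $\alpha$ is $V_h^{q-1}$-valued, $(\alpha,\beta)$ solves the mixed dual problem, $\alpha^t=\operatorname{tr}\alpha$ on $\partial\mathcal T_h$, and $\beta^n$ satisfies (D). Moreover, for every solution $(\alpha,\beta)$ of the mixed dual problem and every $t\in(0,T_{\rm end}]$ there is exactly one $\beta^n(t)\in W_h^{q-1,n}$ that satisfies (D). -/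

import Mathlib

noncomputable section

open MeasureTheory Set
open scoped ContDiff

namespace PHHybrid

/-- The coordinate space `ℝⁿ`. -/
abbrev E (n : ℕ) : Type := EuclideanSpace ℝ (Fin n)

/-- Alternating `k`-linear forms on `ℝⁿ`. -/
abbrev Alt (n k : ℕ) : Type := (E n) [⋀^Fin k]→L[ℝ] ℝ

/-- The `i`-th standard basis vector of `ℝⁿ`. -/
def stdVec {n : ℕ} (i : Fin n) : E n := EuclideanSpace.single i 1

/-! ### Lipschitz domains and metrics -/

/-- Bounded open sets that are locally, in suitable orthonormal coordinates, the region below the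
graph of a Lipschitz function. -/
def IsLipschitzDomain {n : ℕ} (U : Set (E n)) : Prop :=
  IsOpen U ∧ Bornology.IsBounded U ∧
    ∀ x ∈ frontier U, ∃ e : E n, ‖e‖ = 1 ∧ ∃ (K : NNReal) (f : E n → ℝ), LipschitzWith K f ∧
      ∃ δ > 0, ∀ y ∈ Metric.ball x δ, (y ∈ U ↔ inner ℝ y e < f (y - inner ℝ y e • e))

/-- A Riemannian metric on `M`, smooth up to the boundary, through its matrix `(g_{ij})`. -/
structure RiemannianMetric {n : ℕ} (M : Set (E n)) where
  g : E n → Matrix (Fin n) (Fin n) ℝ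
  nhd : Set (E n)
  isOpen_nhd : IsOpen nhd
  closure_subset : closure M ⊆ nhd
  smooth : ∀ i j, ContDiffOn ℝ ∞ (fun x => g x i j) nhd
  posDef : ∀ x ∈ nhd, (g x).PosDef

/-- Inner product of `k`-forms at a point, induced by the metric matrix `G`:
`(1/k!) ∑ G^{i₁j₁} ⋯ G^{iₖjₖ} a_{i₁…iₖ} b_{j₁…jₖ}`. -/
def fiberInner {n k : ℕ} (G : Matrix (Fin n) (Fin n) ℝ) (a b : Alt n k) : ℝ :=
  (1 / (k.factorial : ℝ)) * ∑ i : Fin k → Fin n, ∑ j : Fin k → Fin n,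
    (∏ c, G⁻¹ (i c) (j c)) * a (fun c => stdVec (i c)) * b (fun c => stdVec (j c))

/-- The coefficient of `a ∧ b` with respect to `dx₁ ∧ ⋯ ∧ dxₙ`, i.e. `(a ∧ b)(e₁, …, eₙ)`,
for a `k`-form `a` and an `l`-form `b` with `k + l = n`. -/
def wedgeTop {n k l : ℕ} (h : k + l = n) (a : Alt n k) (b : Alt n l) : ℝ :=
  (1 / ((k.factorial : ℝ) * (l.factorial : ℝ))) * ∑ σ : Equiv.Perm (Fin n),
    ((Equiv.Perm.sign σ : ℤ) : ℝ) *
      a (fun c => stdVec (σ (Fin.cast h (Fin.castAdd l c)))) *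
      b (fun c => stdVec (σ (Fin.cast h (Fin.natAdd k c))))

/-! ### `L²` and `H` spaces of differential forms

Outer oriented forms are represented by ordinary forms through the standard orientation of `ℝⁿ`. -/

/-- `L²Ωᵏ(U)`. -/
abbrev L2Form {n : ℕ} (U : Set (E n)) (k : ℕ) : Type := Lp (Alt n k) 2 (volume.restrict U)

/-- Pairs `(ω, η)` of a square integrable `k`-form and a square integrable `(k+1)`-form. -/
abbrev L2Pair {n : ℕ} (U : Set (E n)) (k : ℕ) : Type := L2Form U k × L2Form U (k + 1)

/-- The `L²` inner product `(ω, η)_U = ∫_U ⟨ω, η⟩_g vol_g`. -/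
def l2Inner {n k : ℕ} (g : E n → Matrix (Fin n) (Fin n) ℝ) {U : Set (E n)}
    (θ η : L2Form U k) : ℝ :=
  ∫ x in U, fiberInner (g x) (θ x) (η x) * Real.sqrt (g x).det

/-- `∫_U (dv ∧ w + (-1)ᵏ v ∧ dw)` for a `k`-form `v` and an `l`-form `w`, `k + l + 1 = n`, where
`v = (v, dv)` and `w = (w, dw)`. -/
def greenForm {n k l : ℕ} (h : k + l + 1 = n) {U : Set (E n)} (v : L2Pair U k)
    (w : L2Pair U l) : ℝ :=
  ∫ x in U, (wedgeTop (by omega : (k + 1) + l = n) (v.2 x) (w.1 x) +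
    (-1) ^ k * wedgeTop (by omega : k + (l + 1) = n) (v.1 x) (w.2 x))

theorem integrable_wedgeTop {n k l : ℕ} (h : k + l = n) {U : Set (E n)} (a : L2Form U k)
    (b : L2Form U l) : Integrable (fun x => wedgeTop h (a x) (b x)) (volume.restrict U) := by
  unfold wedgeTop
  refine Integrable.const_mul ?_ _
  refine integrable_finsetSum _ fun σ _ => ?_
  have ha : MemLp (fun x => (a x) (fun c => stdVec (σ (Fin.cast h (Fin.castAdd l c))))) 2
      (volume.restrict U) :=
    (ContinuousAlternatingMap.apply ℝ (E n) ℝ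
      (fun c => stdVec (σ (Fin.cast h (Fin.castAdd l c))))).comp_memLp' (Lp.memLp a)
  have hb : MemLp (fun x => (b x) (fun c => stdVec (σ (Fin.cast h (Fin.natAdd k c))))) 2
      (volume.restrict U) :=
    (ContinuousAlternatingMap.apply ℝ (E n) ℝ
      (fun c => stdVec (σ (Fin.cast h (Fin.natAdd k c))))).comp_memLp' (Lp.memLp b)
  have := (MemLp.integrable_mul ha hb).const_mul ((Equiv.Perm.sign σ : ℤ) : ℝ)
  simpa [mul_assoc] using this

theorem wedgeTop_add_right {n k l : ℕ} (h : k + l = n) (a : Alt n k) (b b' : Alt n l) :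
    wedgeTop h a (b + b') = wedgeTop h a b + wedgeTop h a b' := by
  simp [wedgeTop, mul_add, Finset.sum_add_distrib]

theorem wedgeTop_smul_right {n k l : ℕ} (h : k + l = n) (c : ℝ) (a : Alt n k) (b : Alt n l) :
    wedgeTop h a (c • b) = c * wedgeTop h a b := by
  simp only [wedgeTop, ContinuousAlternatingMap.smul_apply, smul_eq_mul, Finset.mul_sum]
  refine Finset.sum_congr rfl fun σ _ => ?_
  ring

theorem integrable_green {n k l : ℕ} (h : k + l + 1 = n) {U : Set (E n)} (v : L2Pair U k)
    (w : L2Pair U l) :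
    Integrable (fun x => wedgeTop (by omega : (k + 1) + l = n) (v.2 x) (w.1 x) +
      (-1) ^ k * wedgeTop (by omega : k + (l + 1) = n) (v.1 x) (w.2 x)) (volume.restrict U) :=
  (integrable_wedgeTop _ _ _).add ((integrable_wedgeTop _ _ _).const_mul _)

theorem greenForm_add_right {n k l : ℕ} (h : k + l + 1 = n) {U : Set (E n)} (v : L2Pair U k)
    (w w' : L2Pair U l) : greenForm h v (w + w') = greenForm h v w + greenForm h v w' := by
  unfold greenForm
  rw [← integral_add (integrable_green h v w) (integrable_green h v w')]
  refine integral_congr_ae ?_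
  filter_upwards [Lp.coeFn_add w.1 w'.1, Lp.coeFn_add w.2 w'.2] with x h1 h2
  simp only [Prod.fst_add, Prod.snd_add, h1, h2, Pi.add_apply, wedgeTop_add_right]
  ring

theorem greenForm_smul_right {n k l : ℕ} (h : k + l + 1 = n) {U : Set (E n)} (c : ℝ)
    (v : L2Pair U k) (w : L2Pair U l) : greenForm h v (c • w) = c * greenForm h v w := by
  unfold greenForm
  rw [← integral_const_mul]
  refine integral_congr_ae ?_
  filter_upwards [Lp.coeFn_smul c w.1, Lp.coeFn_smul c w.2] with x h1 h2
  simp only [Prod.smul_fst, Prod.smul_snd, h1, h2, Pi.smul_apply, wedgeTop_smul_right]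
  ring

/-- The pairs `(φ|_U, dφ|_U)`, where `φ` is a smooth compactly supported `k`-form on `ℝⁿ` whose
support lies in `S`. -/
def smoothForms {n : ℕ} (U S : Set (E n)) (k : ℕ) : Submodule ℝ (L2Pair U k) where
  carrier := {z | ∃ φ : E n → Alt n k, ContDiff ℝ ∞ φ ∧ HasCompactSupport φ ∧ tsupport φ ⊆ S ∧
    z.1 =ᵐ[volume.restrict U] φ ∧ z.2 =ᵐ[volume.restrict U] extDeriv φ}
  zero_mem' := by
    refine ⟨0, contDiff_const, HasCompactSupport.zero, by simp [tsupport], Lp.coeFn_zero _ _ _, ?_⟩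
    filter_upwards [Lp.coeFn_zero (Alt n (k + 1)) 2 (volume.restrict U)] with x hx
    have : extDeriv (0 : E n → Alt n k) x = 0 := by
      simpa using extDeriv_smul (x := x) (0 : ℝ) (0 : E n → Alt n k)
    rw [this]
    exact hx
  add_mem' := by
    rintro z z' ⟨φ, h1, h2, h3, h4, h5⟩ ⟨φ', h1', h2', h3', h4', h5'⟩
    refine ⟨φ + φ', h1.add h1', h2.add h2', ?_, ?_, ?_⟩
    · exact (closure_mono (Function.support_add φ φ')).trans
        (by rw [closure_union]; exact union_subset h3 h3')
    · filter_upwards [Lp.coeFn_add z.1 z'.1, h4, h4'] with x a b c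
      simp only [Prod.fst_add, a, Pi.add_apply, b, c]
    · filter_upwards [Lp.coeFn_add z.2 z'.2, h5, h5'] with x a b c
      rw [extDeriv_add (h1.differentiable (by simp) x) (h1'.differentiable (by simp) x)]
      simp only [Prod.snd_add, a, Pi.add_apply, b, c]
  smul_mem' := by
    rintro r z ⟨φ, h1, h2, h3, h4, h5⟩
    have hs : Function.support (r • φ) ⊆ Function.support φ := Function.support_const_smul_subset r φ
    refine ⟨r • φ, h1.const_smul r, h2.mono hs, (closure_mono hs).trans h3, ?_, ?_⟩
    · filter_upwards [Lp.coeFn_smul r z.1, h4] with x a b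
      simp only [Prod.smul_fst, a, Pi.smul_apply, b]
    · filter_upwards [Lp.coeFn_smul r z.2, h5] with x a b
      rw [extDeriv_smul]
      simp only [Prod.smul_snd, a, Pi.smul_apply, b]

/-- The graph of the exterior derivative `d : HΩᵏ(U) → L²Ωᵏ⁺¹(U)` in the sense of distributions:
`(ω, η)` belongs to it, i.e. `dω = η`, iff `∫_U (dφ ∧ ω + (-1)^m φ ∧ η) = 0` for all smooth
`m`-forms `φ` with compact support in `U`, `m = n - k - 1`. For `k = n` there is no condition and
`η = 0`. -/
def graphD {n : ℕ} (U : Set (E n)) (k : ℕ) : Submodule ℝ (L2Pair U k) where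
  carrier := {w | ∀ (m : ℕ) (h : m + k + 1 = n), ∀ φ ∈ smoothForms U U m, greenForm h φ w = 0}
  zero_mem' := by
    intro m h φ _
    simpa using greenForm_smul_right h 0 φ (0 : L2Pair U k)
  add_mem' := by
    intro w w' hw hw' m h φ hφ
    rw [greenForm_add_right, hw m h φ hφ, hw' m h φ hφ, add_zero]
  smul_mem' := by
    intro c w hw m h φ hφ
    rw [greenForm_smul_right, hw m h φ hφ, mul_zero]

/-- `HΩᵏ(U)`, each form being stored together with its exterior derivative; the norm is equivalent
to the graph norm. -/
def HForm {n : ℕ} (U : Set (E n)) (k : ℕ) : Type := graphD U k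

instance {n : ℕ} (U : Set (E n)) (k : ℕ) : NormedAddCommGroup (HForm U k) :=
  inferInstanceAs (NormedAddCommGroup (graphD U k))

instance {n : ℕ} (U : Set (E n)) (k : ℕ) : NormedSpace ℝ (HForm U k) :=
  inferInstanceAs (NormedSpace ℝ (graphD U k))

/-- The pair `(ω, dω)`. -/
def HForm.pair {n : ℕ} (U : Set (E n)) (k : ℕ) : HForm U k →ₗ[ℝ] L2Pair U k :=
  (graphD U k).subtype

/-- The underlying `L²` form. -/
def HForm.val {n k : ℕ} {U : Set (E n)} (θ : HForm U k) : L2Form U k := (HForm.pair U k θ).1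

/-- The exterior derivative `dω`. -/
def HForm.d {n k : ℕ} {U : Set (E n)} (θ : HForm U k) : L2Form U (k + 1) := (HForm.pair U k θ).2

/-- The closure in `HΩᵏ(U)` of the restrictions of smooth compactly supported forms with support
in `S`. For `S = U` this is `H̊Ωᵏ(U)`; for `S = (closure Γ)ᶜ` it is the space `HΩᵏ(U, Γ)` of forms
whose tangential trace vanishes on `Γ ⊆ ∂U`. -/
def closureSmooth {n : ℕ} (U S : Set (E n)) (k : ℕ) : Submodule ℝ (HForm U k) :=
  (smoothForms U S k).topologicalClosure.comap (HForm.pair U k)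

/-- `H̊Ωᵏ(U)`. -/
abbrev HForm0 {n : ℕ} (U : Set (E n)) (k : ℕ) : Submodule ℝ (HForm U k) := closureSmooth U U k

/-- `HΩᵏ(U, Γ)`. -/
abbrev HFormVanishing {n : ℕ} (U Γ : Set (E n)) (k : ℕ) : Submodule ℝ (HForm U k) :=
  closureSmooth U (closure Γ)ᶜ k

/-- Tangential traces of `k`-forms on `∂U`, as `HΩᵏ(U) / H̊Ωᵏ(U)`. -/
def TraceSpace {n : ℕ} (U : Set (E n)) (k : ℕ) : Type := HForm U k ⧸ HForm0 U k

instance {n : ℕ} (U : Set (E n)) (k : ℕ) : AddCommGroup (TraceSpace U k) :=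
  inferInstanceAs (AddCommGroup (HForm U k ⧸ HForm0 U k))

instance {n : ℕ} (U : Set (E n)) (k : ℕ) : Module ℝ (TraceSpace U k) :=
  inferInstanceAs (Module ℝ (HForm U k ⧸ HForm0 U k))

/-- The tangential trace `ω ↦ tr ω` on `∂U`. -/
def tr {n : ℕ} (U : Set (E n)) (k : ℕ) : HForm U k →ₗ[ℝ] TraceSpace U k := (HForm0 U k).mkQ

/-- Tangential traces on `Γ ⊆ ∂U`, as `HΩᵏ(U) / HΩᵏ(U, Γ)`. -/
def TraceSpaceOn {n : ℕ} (U Γ : Set (E n)) (k : ℕ) : Type := HForm U k ⧸ HFormVanishing U Γ k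

instance {n : ℕ} (U Γ : Set (E n)) (k : ℕ) : AddCommGroup (TraceSpaceOn U Γ k) :=
  inferInstanceAs (AddCommGroup (HForm U k ⧸ HFormVanishing U Γ k))

instance {n : ℕ} (U Γ : Set (E n)) (k : ℕ) : Module ℝ (TraceSpaceOn U Γ k) :=
  inferInstanceAs (Module ℝ (HForm U k ⧸ HFormVanishing U Γ k))

/-- The tangential trace `ω ↦ tr ω|_Γ`. -/
def trOn {n : ℕ} (U Γ : Set (E n)) (k : ℕ) : HForm U k →ₗ[ℝ] TraceSpaceOn U Γ k :=
  (HFormVanishing U Γ k).mkQ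

theorem trOn_surjective {n : ℕ} (U Γ : Set (E n)) (k : ℕ) : Function.Surjective (trOn U Γ k) :=
  Submodule.mkQ_surjective _

/-- The duality product `⟨tr v | u⟩_Γ = ∫_Γ tr v ∧ u` of a `k`-form `v` whose trace vanishes on the
complementary part `Γ'` of the boundary and a trace `u = tr w|_Γ` of an `l`-form, `k + l + 1 = n`,
in the form `∫_U (dv ∧ w + (-1)ᵏ v ∧ dw)`. It does not depend on the representative `w`: if
`closure Γ ∪ closure Γ' = ∂U`, `v ∈ HΩᵏ(U, Γ')` and `w ∈ HΩˡ(U, Γ)`, then the integral is a limit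
of integrals of `d(φ ∧ ψ)` with `φ ∧ ψ` smooth and supported away from `∂U`, hence zero. -/
def bdryDual {n k l : ℕ} (h : k + l + 1 = n) {U Γ : Set (E n)} (v : HForm U k)
    (u : TraceSpaceOn U Γ l) : ℝ :=
  greenForm h (HForm.pair U k v) (HForm.pair U l (Function.surjInv (trOn_surjective U Γ l) u))

/-! ### Restriction to subdomains -/

/-- Restriction `L²Ωᵏ(U) → L²Ωᵏ(T)` for `T ⊆ U`. -/
def restrictL2 {n : ℕ} {T U : Set (E n)} (h : T ⊆ U) (k : ℕ) : L2Form U k →ₗ[ℝ] L2Form T k where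
  toFun θ := ((Lp.memLp θ).mono_measure (Measure.restrict_mono_set volume h)).toLp θ
  map_add' θ η := by
    rw [← MemLp.toLp_add]
    exact MemLp.toLp_congr _ _
      (ae_restrict_of_ae_restrict_of_subset h (Lp.coeFn_add θ η))
  map_smul' c θ := by
    rw [RingHom.id_apply, ← MemLp.toLp_const_smul]
    exact MemLp.toLp_congr _ _
      (ae_restrict_of_ae_restrict_of_subset h (Lp.coeFn_smul c θ))

theorem coeFn_restrictL2 {n k : ℕ} {T U : Set (E n)} (h : T ⊆ U) (θ : L2Form U k) :
    restrictL2 h k θ =ᵐ[volume.restrict T] θ :=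
  MemLp.coeFn_toLp ((Lp.memLp θ).mono_measure (Measure.restrict_mono_set volume h))

theorem continuous_extDeriv {n k : ℕ} {φ : E n → Alt n k} (h : ContDiff ℝ ∞ φ) :
    Continuous (extDeriv φ) :=
  (ContinuousAlternatingMap.alternatizeUncurryFinCLM ℝ (E n) ℝ).continuous.comp
    (h.continuous_fderiv (by simp))

theorem extDeriv_eq_zero {n k : ℕ} {φ : E n → Alt n k} {x : E n} (hx : x ∉ tsupport φ) :
    extDeriv φ x = 0 := by
  have h : fderiv ℝ φ x = 0 := by
    by_contra hne
    exact hx (support_fderiv_subset ℝ hne)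
  have h2 : extDeriv φ x = ContinuousAlternatingMap.alternatizeUncurryFinCLM ℝ (E n) ℝ
    (fderiv ℝ φ x) := rfl
  rw [h2, h, map_zero]

theorem hasCompactSupport_extDeriv {n k : ℕ} {φ : E n → Alt n k} (h : HasCompactSupport φ) :
    HasCompactSupport (extDeriv φ) :=
  HasCompactSupport.intro h fun _ hx => extDeriv_eq_zero hx

theorem wedgeTop_zero_left {n k l : ℕ} (h : k + l = n) (b : Alt n l) :
    wedgeTop h (0 : Alt n k) b = 0 := by
  simp [wedgeTop]

theorem restrict_mem_graphD {n k : ℕ} {T U : Set (E n)} (hU : IsOpen U) (hTU : T ⊆ U)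
    {w : L2Pair U k} (hw : w ∈ graphD U k) :
    (restrictL2 hTU k w.1, restrictL2 hTU (k + 1) w.2) ∈ graphD T k := by
  rintro m h z ⟨φ, h1, h2, h3, h4, h5⟩
  have m1 : MemLp φ 2 (volume.restrict U) := h1.continuous.memLp_of_hasCompactSupport h2
  have m2 : MemLp (extDeriv φ) 2 (volume.restrict U) :=
    (continuous_extDeriv h1).memLp_of_hasCompactSupport (hasCompactSupport_extDeriv h2)
  have key := hw m h (m1.toLp, m2.toLp)
    ⟨φ, h1, h2, h3.trans hTU, m1.coeFn_toLp, m2.coeFn_toLp⟩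
  rw [← key]
  have e1 : greenForm h z (restrictL2 hTU k w.1, restrictL2 hTU (k + 1) w.2) =
      ∫ x in T, (wedgeTop (by omega : (m + 1) + k = n) (extDeriv φ x) (w.1 x) +
        (-1) ^ m * wedgeTop (by omega : m + (k + 1) = n) (φ x) (w.2 x)) := by
    refine integral_congr_ae ?_
    filter_upwards [h4, h5, coeFn_restrictL2 hTU w.1, coeFn_restrictL2 hTU w.2] with x a b c e
    simp only [a, b, c, e]
  have e2 : greenForm h ((m1.toLp, m2.toLp) : L2Pair U m) w =
      ∫ x in U, (wedgeTop (by omega : (m + 1) + k = n) (extDeriv φ x) (w.1 x) +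
        (-1) ^ m * wedgeTop (by omega : m + (k + 1) = n) (φ x) (w.2 x)) := by
    refine integral_congr_ae ?_
    filter_upwards [m1.coeFn_toLp, m2.coeFn_toLp] with x a b
    simp only [a, b]
  rw [e1, e2]
  refine (setIntegral_eq_of_subset_of_forall_sdiff_eq_zero hU.measurableSet hTU ?_).symm
  intro x hx
  have hx' : x ∉ tsupport φ := fun hmem => hx.2 (h3 hmem)
  rw [extDeriv_eq_zero hx', image_eq_zero_of_notMem_tsupport hx', wedgeTop_zero_left,
    wedgeTop_zero_left, mul_zero, add_zero]

/-- Restriction `HΩᵏ(U) → HΩᵏ(T)` for `T ⊆ U`. -/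
def restrictH {n : ℕ} {T U : Set (E n)} (hU : IsOpen U) (h : T ⊆ U) (k : ℕ) :
    HForm U k →ₗ[ℝ] HForm T k :=
  LinearMap.restrict (p := graphD U k) (q := graphD T k)
    ((restrictL2 h k).prodMap (restrictL2 h (k + 1))) fun _ hw => restrict_mem_graphD hU h hw

/-! ### Meshes, finite element spaces and facet spaces -/

/-- A decomposition of the Lipschitz domain `M` into finitely many disjoint Lipschitz elements. -/
structure Mesh {n : ℕ} (M : Set (E n)) (ι : Type) where
  lipschitz_domain : IsLipschitzDomain M
  T : ι → Set (E n)
  lipschitz : ∀ i, IsLipschitzDomain (T i)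
  subset : ∀ i, T i ⊆ M
  disjoint : Pairwise fun i j => Disjoint (T i) (T j)
  cover : volume (M \ ⋃ i, T i) = 0

/-- `Γ₁`, `Γ₂` are disjoint relatively open subsets of `∂M` whose closures cover `∂M`. -/
structure IsBoundaryPartition {n : ℕ} (M Γ₁ Γ₂ : Set (E n)) : Prop where
  isOpen_left : ∃ O, IsOpen O ∧ Γ₁ = O ∩ frontier M
  isOpen_right : ∃ O, IsOpen O ∧ Γ₂ = O ∩ frontier M
  disjoint : Disjoint Γ₁ Γ₂
  cover : closure Γ₁ ∪ closure Γ₂ = frontier M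

variable {n : ℕ} {M : Set (E n)} {ι : Type}

/-- Local finite element spaces `W_hᵏ(T) ⊆ HΩᵏ(T)`: a finite dimensional subcomplex for each
element. -/
structure FESpaces (𝒯 : Mesh M ι) where
  W : ∀ (k : ℕ) (i : ι), Submodule ℝ (HForm (𝒯.T i) k)
  finite : ∀ k i, FiniteDimensional ℝ (W k i)
  subcomplex : ∀ k i, ∀ θ ∈ W k i, ∃ η ∈ W (k + 1) i, HForm.val η = HForm.d θ

/-- The broken space `HΩᵏ(𝒯_h) = ∏_T HΩᵏ(T)`. -/
abbrev Broken (𝒯 : Mesh M ι) (k : ℕ) : Type := ∀ i, HForm (𝒯.T i) k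

/-- The inclusion `HΩᵏ(M) ↪ HΩᵏ(𝒯_h)` by restriction to the elements. -/
def restrictB (𝒯 : Mesh M ι) (k : ℕ) : HForm M k →ₗ[ℝ] Broken 𝒯 k :=
  LinearMap.pi fun i => restrictH 𝒯.lipschitz_domain.1 (𝒯.subset i) k

/-- The broken inner product `(θ, η)_{𝒯_h} = ∑_T (θ, η)_T`, i.e. the inner product of
`L²Ωᵏ(𝒯_h) ≅ L²Ωᵏ(M)`. -/
def brokenInner [Fintype ι] (g : RiemannianMetric M) {𝒯 : Mesh M ι} {k : ℕ}
    (θ η : ∀ i, L2Form (𝒯.T i) k) : ℝ :=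
  ∑ i, l2Inner g.g (θ i) (η i)

/-- The `L²` part of a broken form. -/
def Broken.val {𝒯 : Mesh M ι} {k : ℕ} (θ : Broken 𝒯 k) (i : ι) : L2Form (𝒯.T i) k :=
  HForm.val (θ i)

/-- The elementwise exterior derivative of a broken form. -/
def Broken.d {𝒯 : Mesh M ι} {k : ℕ} (θ : Broken 𝒯 k) (i : ι) : L2Form (𝒯.T i) (k + 1) :=
  HForm.d (θ i)

section spaces

variable {𝒯 : Mesh M ι} (D : FESpaces 𝒯) (Γ : Set (E n)) (k : ℕ)

/-- `W_hᵏ = ∏_T W_hᵏ(T)`. -/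
def Wh : Submodule ℝ (Broken 𝒯 k) := Submodule.pi univ fun i => D.W k i

/-- The conforming space `V_hᵏ = HΩᵏ(M) ∩ W_hᵏ`. -/
def Vh : Submodule ℝ (HForm M k) := (Wh D k).comap (restrictB 𝒯 k)

/-- The inclusion `V_hᵏ ↪ W_hᵏ`. -/
def toBroken : Vh D k →ₗ[ℝ] Wh D k := (restrictB 𝒯 k).restrict fun _ hv => hv

/-- `V_hᵏ(Γ)`: the elements of `V_hᵏ` with vanishing tangential trace on `Γ`. -/
def VhVanishing : Submodule ℝ (Vh D k) := (HFormVanishing M Γ k).comap (Vh D k).subtype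

/-- The control space `tr V_hᵏ|_Γ`. -/
def ControlSpace : Submodule ℝ (TraceSpaceOn M Γ k) := (Vh D k).map (trOn M Γ k)

/-- The tangential trace of broken forms on `∂𝒯_h = ⨆_T ∂T`. -/
def trBroken (𝒯 : Mesh M ι) (k : ℕ) :
    Broken 𝒯 k →ₗ[ℝ] ∀ i, TraceSpace (𝒯.T i) k :=
  LinearMap.pi fun i => tr (𝒯.T i) k ∘ₗ LinearMap.proj i

/-- The broken tangential traces `W_h^{k,t} = tr W_hᵏ`. -/
def Wt : Submodule ℝ (∀ i, TraceSpace (𝒯.T i) k) := (Wh D k).map (trBroken 𝒯 k)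

/-- The trace map `tr : W_hᵏ → W_h^{k,t}`. -/
def trW : Wh D k →ₗ[ℝ] Wt D k := (trBroken 𝒯 k).submoduleMap (Wh D k)

/-- The trace map `V_hᵏ → W_h^{k,t}` on `∂𝒯_h`. -/
def trV : Vh D k →ₗ[ℝ] Wt D k := trW D k ∘ₗ toBroken D k

/-- The unbroken (single valued) tangential traces `V_h^{k,t} = tr V_hᵏ`. -/
def Vt : Submodule ℝ (Wt D k) := LinearMap.range (trV D k)

/-- The broken normal traces `W_h^{k,n} = (W_h^{k,t})*`; the pairing `⟨·, ·⟩_{∂𝒯_h}` of `W_h^{k,n}`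
and `W_h^{k,t}` is evaluation. -/
abbrev Wn : Type := Module.Dual ℝ (Wt D k)

variable {D k}

/-- `c • b|_Γ = u` for a single valued facet trace `b = tr v`, `v ∈ V_hᵏ`. -/
def FacetRestrictsTo {Γ : Set (E n)} (c : ℝ) (b : Wt D k) (u : TraceSpaceOn M Γ k) : Prop :=
  ∃ v : Vh D k, trV D k v = b ∧ c • trOn M Γ k v.1 = u

end spaces

/-! ### The discrete problems

Throughout `p = r + 1` and `q = s + 1`, so that `p + q = n + 1` reads `r + s + 1 = n`. Time runs
through `(0, Tend]`. `Dh` and `D` are the finite element spaces for outer and inner oriented forms. -/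

section problems

variable [Fintype ι] (g : RiemannianMetric M) {𝒯 : Mesh M ι} (Dh D : FESpaces 𝒯)
  (Γ₁ Γ₂ : Set (E n)) {r s : ℕ} (h : r + s + 1 = n) (Tend : ℝ)
  (u₁ : ℝ → ControlSpace D Γ₁ s) (u₂ : ℝ → ControlSpace Dh Γ₂ r)

/-- The discrete mixed Galerkin primal system for `α ∈ W_hᵖ`, `β ∈ V_h^{p-1}`. -/
structure IsMixedPrimal (α : ℝ → Wh Dh (r + 1)) (β : ℝ → Vh Dh r) : Prop where
  diff_α : DifferentiableOn ℝ α (Ioc 0 Tend)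
  diff_β : DifferentiableOn ℝ β (Ioc 0 Tend)
  essential : ∀ t ∈ Ioc 0 Tend, (-1 : ℝ) ^ (r + 1) • trOn M Γ₂ r (β t).1 = (u₂ t).1
  eq₁ : ∀ t ∈ Ioc 0 Tend, ∀ v : Wh Dh (r + 1),
    brokenInner g v.1.val (derivWithin α (Ioc 0 Tend) t).1.val =
      (-1) ^ (r + 1) * brokenInner g v.1.val (toBroken Dh r (β t)).1.d
  eq₂ : ∀ t ∈ Ioc 0 Tend, ∀ v ∈ VhVanishing Dh Γ₂ r,
    brokenInner g (toBroken Dh r v).1.val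
        (toBroken Dh r (derivWithin β (Ioc 0 Tend) t)).1.val =
      (-1) ^ (r + 1) * (-brokenInner g (toBroken Dh r v).1.d (α t).1.val
        + bdryDual h v.1 (u₁ t).1)

/-- The second equation of the discrete hybrid primal system at time `t`, as a condition on the
normal trace `αn ∈ W_h^{p-1,n}`. -/
def HybridPrimalEq₂ (α : ℝ → Wh Dh (r + 1)) (β : ℝ → Wh Dh r) (t : ℝ) (αn : Wn Dh r) : Prop :=
  ∀ v : Wh Dh r,
    brokenInner g v.1.val (derivWithin β (Ioc 0 Tend) t).1.val =
      (-1) ^ (r + 1) * (-brokenInner g v.1.d (α t).1.val + αn (trW Dh r v))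

/-- The discrete hybrid primal system for `α ∈ W_hᵖ`, `β ∈ W_h^{p-1}`, `αn ∈ W_h^{p-1,n}`,
`βt ∈ V_h^{p-1,t}`. In `eq₄` the test functions in `V_h^{p-1,t}(Γ₂)` are the traces `tr v` of
`v ∈ V_h^{p-1}(Γ₂)`. -/
structure IsHybridPrimal (α : ℝ → Wh Dh (r + 1)) (β : ℝ → Wh Dh r) (αn : ℝ → Wn Dh r)
    (βt : ℝ → Wt Dh r) : Prop where
  diff_α : DifferentiableOn ℝ α (Ioc 0 Tend)
  diff_β : DifferentiableOn ℝ β (Ioc 0 Tend)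
  mem_Vt : ∀ t ∈ Ioc 0 Tend, βt t ∈ Vt Dh r
  essential : ∀ t ∈ Ioc 0 Tend, FacetRestrictsTo ((-1) ^ (r + 1)) (βt t) (u₂ t).1
  eq₁ : ∀ t ∈ Ioc 0 Tend, ∀ v : Wh Dh (r + 1),
    brokenInner g v.1.val (derivWithin α (Ioc 0 Tend) t).1.val =
      (-1) ^ (r + 1) * brokenInner g v.1.val (β t).1.d
  eq₂ : ∀ t ∈ Ioc 0 Tend, HybridPrimalEq₂ g Dh Tend α β t (αn t)
  eq₃ : ∀ t ∈ Ioc 0 Tend, ∀ vn : Wn Dh r, 0 = -(-1) ^ (r + 1) * vn (trW Dh r (β t) - βt t)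
  eq₄ : ∀ t ∈ Ioc 0 Tend, ∀ v ∈ VhVanishing Dh Γ₂ r,
    0 = (-1) ^ (r + 1) * (-αn t (trV Dh r v) + bdryDual h v.1 (u₁ t).1)

/-- The discrete mixed Galerkin dual system for `α ∈ V_h^{q-1}`, `β ∈ W_h^q`. -/
structure IsMixedDual (α : ℝ → Vh D s) (β : ℝ → Wh D (s + 1)) : Prop where
  diff_α : DifferentiableOn ℝ α (Ioc 0 Tend)
  diff_β : DifferentiableOn ℝ β (Ioc 0 Tend)
  essential : ∀ t ∈ Ioc 0 Tend, trOn M Γ₁ s (α t).1 = (u₁ t).1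
  eq₁ : ∀ t ∈ Ioc 0 Tend, ∀ v ∈ VhVanishing D Γ₁ s,
    brokenInner g (toBroken D s v).1.val (toBroken D s (derivWithin α (Ioc 0 Tend) t)).1.val =
      brokenInner g (toBroken D s v).1.d (β t).1.val
        + (-1) ^ (r * s) * bdryDual (by omega : s + r + 1 = n) v.1 (u₂ t).1
  eq₂ : ∀ t ∈ Ioc 0 Tend, ∀ v : Wh D (s + 1),
    brokenInner g v.1.val (derivWithin β (Ioc 0 Tend) t).1.val =
      -brokenInner g v.1.val (toBroken D s (α t)).1.d

/-- The first equation of the discrete hybrid dual system at time `t`, as a condition on the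
normal trace `βn ∈ W_h^{q-1,n}`. -/
def HybridDualEq₁ (α : ℝ → Wh D s) (β : ℝ → Wh D (s + 1)) (t : ℝ) (βn : Wn D s) : Prop :=
  ∀ v : Wh D s,
    brokenInner g v.1.val (derivWithin α (Ioc 0 Tend) t).1.val =
      brokenInner g v.1.d (β t).1.val - βn (trW D s v)

/-- The discrete hybrid dual system for `α ∈ W_h^{q-1}`, `β ∈ W_h^q`, `βn ∈ W_h^{q-1,n}`,
`αt ∈ V_h^{q-1,t}`. In `eq₄` the test functions in `V_h^{q-1,t}(Γ₁)` are the traces `tr v` of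
`v ∈ V_h^{q-1}(Γ₁)`. -/
structure IsHybridDual (α : ℝ → Wh D s) (β : ℝ → Wh D (s + 1)) (βn : ℝ → Wn D s)
    (αt : ℝ → Wt D s) : Prop where
  diff_α : DifferentiableOn ℝ α (Ioc 0 Tend)
  diff_β : DifferentiableOn ℝ β (Ioc 0 Tend)
  mem_Vt : ∀ t ∈ Ioc 0 Tend, αt t ∈ Vt D s
  essential : ∀ t ∈ Ioc 0 Tend, FacetRestrictsTo 1 (αt t) (u₁ t).1
  eq₁ : ∀ t ∈ Ioc 0 Tend, HybridDualEq₁ g D Tend α β t (βn t)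
  eq₂ : ∀ t ∈ Ioc 0 Tend, ∀ v : Wh D (s + 1),
    brokenInner g v.1.val (derivWithin β (Ioc 0 Tend) t).1.val =
      -brokenInner g v.1.val (α t).1.d
  eq₃ : ∀ t ∈ Ioc 0 Tend, ∀ vn : Wn D s, 0 = vn (trW D s (α t) - αt t)
  eq₄ : ∀ t ∈ Ioc 0 Tend, ∀ v ∈ VhVanishing D Γ₁ s,
    0 = βn t (trV D s v) + (-1) ^ (r * s) * bdryDual (by omega : s + r + 1 = n) v.1 (u₂ t).1

end problems

end PHHybrid

end

noncomputable section

open MeasureTheory Set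
open scoped ContDiff

namespace PHHybrid

/-! ### Stokes' theorem for products of smooth compactly supported forms -/

/-! The analytic core is a gluing fact: a broken form whose trace vanishes on every element boundary
is the restriction of a form in `HForm0 M k` (`exists_restrictB_of_trBroken_eq_zero`). Each piece is
an L² limit, together with its derivative, of smooth forms compactly supported in its element.
Extension by zero is an isometry taking such smooth forms to smooth forms compactly supported in
`M`, so limits go to limits, and the extended pieces add up. That the limits still lie in HΩ(M)
needs the classical exterior derivative to be the distributional one, which is Stokes' theorem for φ
∧ ψ (`greenForm_smoothForms`), and the distributional derivative to be closed (`isClosed_graphD`).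

Two consequences connect the formulations. A broken finite element form that shares its facet trace
with a conforming one differs from it by a form in `HForm0 M k`, hence is itself conforming
(`exists_conforming_of_trW_mem_Vt`). A functional on `Wh` that kills the forms with zero facet trace
factors uniquely through `trW`, that is, it is a normal trace (`existsUnique_normalTrace`).

The equivalence then follows at each fixed time. Testing the third hybrid equation with the whole
dual space identifies the facet unknown with the trace, so the solution is conforming. For
conforming test functions, the facet balance exchanges the normal trace term for the boundary input,
turning the local equation into the mixed one and back. For existence of the normal trace, the local
equation prescribes a functional; on forms from `HForm0` the mixed equation makes it vanish, because
the boundary input does not see them (`bdryDual_HForm0`). Time derivatives pass between `Vh` and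
`Wh` because both are finite dimensional and the inclusion is injective. -/

theorem extDeriv_apply_sum {n k : ℕ} {φ : E n → Alt n k} (x : E n) (v : Fin (k + 1) → E n) :
    extDeriv φ x v =
      ∑ i : Fin (k + 1), (-1) ^ (i : ℕ) * fderiv ℝ φ x (v i) (fun c => v (i.succAbove c)) := by
  rw [extDeriv, ContinuousAlternatingMap.alternatizeUncurryFin_apply]
  simp only [Int.reduceNeg, zsmul_eq_mul, Int.cast_pow, Int.cast_neg, Int.cast_one]
  rfl

/-- Reindexing by a cycle that moves position `a` to the front costs its sign, (-1)^a. This brings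
the differentiated slot of every term of `extDeriv` to position 0. -/
theorem sum_perm_mul_cycleRange {N : ℕ} (a : Fin N) (F : Equiv.Perm (Fin N) → ℝ) :
    ∑ σ : Equiv.Perm (Fin N), ((Equiv.Perm.sign σ : ℤ) : ℝ) * F σ =
      (-1) ^ (a : ℕ) * ∑ σ : Equiv.Perm (Fin N),
        ((Equiv.Perm.sign σ : ℤ) : ℝ) * F (σ * a.cycleRange) := by
  rw [← Equiv.sum_comp (Equiv.mulRight a.cycleRange), Finset.mul_sum]
  refine Finset.sum_congr rfl fun σ _ => ?_
  simp only [Equiv.coe_mulRight, Equiv.Perm.sign_mul, Fin.sign_cycleRange]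
  push_cast
  ring

/-- `dφ ∧ ψ` through the partial derivatives of the components of `φ`. -/
theorem wedgeTop_extDeriv_left {m k : ℕ} (φ : E (m + k + 1) → Alt (m + k + 1) m)
    (b : Alt (m + k + 1) k) (x : E (m + k + 1)) (h : m + 1 + k = m + k + 1) :
    wedgeTop h (extDeriv φ x) b =
      (1 / ((m.factorial : ℝ) * (k.factorial : ℝ))) * ∑ σ : Equiv.Perm (Fin (m + k + 1)),
        ((Equiv.Perm.sign σ : ℤ) : ℝ) *
          (fderiv ℝ φ x (stdVec (σ 0)) (fun c => stdVec (σ (Fin.castAdd k c).succ)) *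
            b (fun c => stdVec (σ (Fin.natAdd m c).succ))) := by
  set S := ∑ σ : Equiv.Perm (Fin (m + k + 1)), ((Equiv.Perm.sign σ : ℤ) : ℝ) *
          (fderiv ℝ φ x (stdVec (σ 0)) (fun c => stdVec (σ (Fin.castAdd k c).succ)) *
            b (fun c => stdVec (σ (Fin.natAdd m c).succ))) with hS
  -- All `m + 1` terms of the alternating sum contribute equally: the sign of the cycle cancels the
  -- sign of the term. The resulting factor `m + 1` turns `(m + 1)!` into `m!`.
  have key : ∀ i : Fin (m + 1), ∑ σ : Equiv.Perm (Fin (m + k + 1)),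
      ((Equiv.Perm.sign σ : ℤ) : ℝ) * ((-1) ^ (i : ℕ) *
        fderiv ℝ φ x (stdVec (σ (Fin.cast h (Fin.castAdd k i))))
          (fun c => stdVec (σ (Fin.cast h (Fin.castAdd k (i.succAbove c))))) *
        b (fun c => stdVec (σ (Fin.cast h (Fin.natAdd (m + 1) c))))) = S := by
    intro i
    rw [sum_perm_mul_cycleRange (Fin.cast h (Fin.castAdd k i)), Finset.mul_sum]
    refine Finset.sum_congr rfl fun σ _ => ?_
    have h0 : (Fin.cast h (Fin.castAdd k i)).cycleRange (Fin.cast h (Fin.castAdd k i)) = 0 :=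
      Fin.cycleRange_self _
    have h1 : ∀ c : Fin m, (Fin.cast h (Fin.castAdd k i)).cycleRange
        (Fin.cast h (Fin.castAdd k (i.succAbove c))) = (Fin.castAdd k c).succ := by
      intro c
      -- The cycle sends the c-th position other than its base to `c.succ`; it remains to compare
      -- `succAbove` before and after the cast.
      rw [← Fin.cycleRange_succAbove (Fin.cast h (Fin.castAdd k i))]
      congr 1
      ext
      simp only [Fin.succAbove, Fin.lt_def, Fin.val_cast, Fin.val_castAdd, Fin.val_castSucc]
      split_ifs <;> simp
    have h2 : ∀ c : Fin k, (Fin.cast h (Fin.castAdd k i)).cycleRange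
        (Fin.cast h (Fin.natAdd (m + 1) c)) = (Fin.natAdd m c).succ := by
      intro c
      -- The slots of the second factor come after the base of the cycle and stay fixed.
      rw [Fin.cycleRange_of_gt (by simp [Fin.lt_def]; omega)]
      ext
      simp; omega
    have hs : ((-1 : ℝ) ^ (i : ℕ)) * (-1) ^ (i : ℕ) = 1 := by
      rw [← mul_pow]; simp
    simp only [Equiv.Perm.mul_apply, h0, h2, h1, Fin.val_cast, Fin.val_castAdd]
    linear_combination (((Equiv.Perm.sign σ : ℤ) : ℝ) *
          (fderiv ℝ φ x (stdVec (σ 0)) (fun c => stdVec (σ (Fin.castAdd k c).succ)) *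
            b (fun c => stdVec (σ (Fin.natAdd m c).succ)))) * hs
  have hsum : ∑ σ : Equiv.Perm (Fin (m + k + 1)), ((Equiv.Perm.sign σ : ℤ) : ℝ) *
      extDeriv φ x (fun c => stdVec (σ (Fin.cast h (Fin.castAdd k c)))) *
      b (fun c => stdVec (σ (Fin.cast h (Fin.natAdd (m + 1) c)))) = (m + 1) * S := by
    have : ∑ _i : Fin (m + 1), S = (m + 1) * S := by simp
    rw [← this, ← Finset.sum_congr rfl fun i _ => key i, Finset.sum_comm]
    refine Finset.sum_congr rfl fun σ _ => ?_
    rw [extDeriv_apply_sum, Finset.mul_sum, Finset.sum_mul]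
    exact Finset.sum_congr rfl fun i _ => by ring
  rw [wedgeTop, hsum, Nat.factorial_succ]
  push_cast
  have := Nat.factorial_ne_zero m
  have := Nat.factorial_ne_zero k
  field_simp

/-- `φ ∧ dψ` through the partial derivatives of the components of `ψ`. -/
theorem wedgeTop_extDeriv_right {m k : ℕ} (a : Alt (m + k + 1) m)
    (ψ : E (m + k + 1) → Alt (m + k + 1) k) (x : E (m + k + 1)) (h : m + (k + 1) = m + k + 1) :
    (-1) ^ m * wedgeTop h a (extDeriv ψ x) =
      (1 / ((m.factorial : ℝ) * (k.factorial : ℝ))) * ∑ σ : Equiv.Perm (Fin (m + k + 1)),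
        ((Equiv.Perm.sign σ : ℤ) : ℝ) *
          (a (fun c => stdVec (σ (Fin.castAdd k c).succ)) *
            fderiv ℝ ψ x (stdVec (σ 0)) (fun c => stdVec (σ (Fin.natAdd m c).succ))) := by
  set S := ∑ σ : Equiv.Perm (Fin (m + k + 1)), ((Equiv.Perm.sign σ : ℤ) : ℝ) *
          (a (fun c => stdVec (σ (Fin.castAdd k c).succ)) *
            fderiv ℝ ψ x (stdVec (σ 0)) (fun c => stdVec (σ (Fin.natAdd m c).succ))) with hS
  -- Here the derivative sits at position `m + i`, so the cycle has sign (-1)^(m+i), and the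
  -- prefactor (-1)^m of the Leibniz rule absorbs the extra part.
  have key : ∀ i : Fin (k + 1), (-1) ^ m * ∑ σ : Equiv.Perm (Fin (m + k + 1)),
      ((Equiv.Perm.sign σ : ℤ) : ℝ) * (a (fun c => stdVec (σ (Fin.cast h (Fin.castAdd (k + 1) c)))) *
        ((-1) ^ (i : ℕ) * fderiv ℝ ψ x (stdVec (σ (Fin.cast h (Fin.natAdd m i))))
          (fun c => stdVec (σ (Fin.cast h (Fin.natAdd m (i.succAbove c))))))) = S := by
    intro i
    rw [sum_perm_mul_cycleRange (Fin.cast h (Fin.natAdd m i)), ← mul_assoc, Finset.mul_sum]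
    refine Finset.sum_congr rfl fun σ _ => ?_
    have h0 : (Fin.cast h (Fin.natAdd m i)).cycleRange (Fin.cast h (Fin.natAdd m i)) = 0 :=
      Fin.cycleRange_self _
    have h1 : ∀ c : Fin k, (Fin.cast h (Fin.natAdd m i)).cycleRange
        (Fin.cast h (Fin.natAdd m (i.succAbove c))) = (Fin.natAdd m c).succ := by
      intro c
      rw [← Fin.cycleRange_succAbove (Fin.cast h (Fin.natAdd m i))]
      congr 1
      ext
      simp only [Fin.succAbove, Fin.lt_def, Fin.val_cast, Fin.val_natAdd, Fin.val_castSucc,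
        add_lt_add_iff_left]
      split_ifs <;> simp [add_assoc]
    have h2 : ∀ c : Fin m, (Fin.cast h (Fin.natAdd m i)).cycleRange
        (Fin.cast h (Fin.castAdd (k + 1) c)) = (Fin.castAdd k c).succ := by
      intro c
      ext
      rw [Fin.coe_cycleRange_of_lt (by simp [Fin.lt_def]; omega)]
      simp
    have hs : ((-1 : ℝ) ^ (i : ℕ)) * (-1) ^ (i : ℕ) = 1 := by
      rw [← mul_pow]; simp
    have hm : ((-1 : ℝ) ^ m) * (-1) ^ m = 1 := by
      rw [← mul_pow]; simp
    simp only [Equiv.Perm.mul_apply, h0, h2, h1, Fin.val_cast, Fin.val_natAdd, pow_add]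
    linear_combination (((Equiv.Perm.sign σ : ℤ) : ℝ) *
          (a (fun c => stdVec (σ (Fin.castAdd k c).succ)) *
            fderiv ℝ ψ x (stdVec (σ 0)) (fun c => stdVec (σ (Fin.natAdd m c).succ)))) *
      (hs + ((-1 : ℝ) ^ (i : ℕ)) * (-1) ^ (i : ℕ) * hm)
  have hsum : (-1) ^ m * ∑ σ : Equiv.Perm (Fin (m + k + 1)), ((Equiv.Perm.sign σ : ℤ) : ℝ) *
      a (fun c => stdVec (σ (Fin.cast h (Fin.castAdd (k + 1) c)))) *
      extDeriv ψ x (fun c => stdVec (σ (Fin.cast h (Fin.natAdd m c)))) = (k + 1) * S := by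
    have : ∑ _i : Fin (k + 1), S = (k + 1) * S := by simp
    rw [← this, ← Finset.sum_congr rfl fun i _ => key i, ← Finset.mul_sum, Finset.sum_comm]
    congr 1
    refine Finset.sum_congr rfl fun σ _ => ?_
    rw [extDeriv_apply_sum, Finset.mul_sum]
    exact Finset.sum_congr rfl fun i _ => by ring
  rw [wedgeTop, mul_left_comm, hsum, Nat.factorial_succ]
  push_cast
  have := Nat.factorial_ne_zero m
  have := Nat.factorial_ne_zero k
  field_simp

/-- The integrand is a directional derivative of the compactly supported product of two components.
Integrability is kept alongside because the integral must later be exchanged with the sum over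
permutations. -/
theorem integral_fderiv_component_mul {n m k : ℕ} {φ : E n → Alt n m} {ψ : E n → Alt n k}
    (h1 : ContDiff ℝ ∞ φ) (h2 : HasCompactSupport φ) (h1' : ContDiff ℝ ∞ ψ)
    (h2' : HasCompactSupport ψ) (e : E n) (v : Fin m → E n) (w : Fin k → E n) :
    Integrable (fun x => fderiv ℝ φ x e v * ψ x w + φ x v * fderiv ℝ ψ x e w) ∧
      ∫ x, (fderiv ℝ φ x e v * ψ x w + φ x v * fderiv ℝ ψ x e w) = 0 := by
  have c1 : ContDiff ℝ ∞ fun x => φ x v :=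
    (ContinuousAlternatingMap.apply ℝ (E n) ℝ v).contDiff.comp h1
  have c2 : ContDiff ℝ ∞ fun x => ψ x w :=
    (ContinuousAlternatingMap.apply ℝ (E n) ℝ w).contDiff.comp h1'
  have d1 : ∀ x, fderiv ℝ (fun x => φ x v) x e = fderiv ℝ φ x e v := fun x =>
    fderiv_continuousAlternatingMap_apply_const_apply (h1.differentiable (by simp) x) v e
  have d2 : ∀ x, fderiv ℝ (fun x => ψ x w) x e = fderiv ℝ ψ x e w := fun x =>
    fderiv_continuousAlternatingMap_apply_const_apply (h1'.differentiable (by simp) x) w e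
  have s1 : HasCompactSupport fun x => φ x v :=
    HasCompactSupport.intro h2 fun x hx => by simp [image_eq_zero_of_notMem_tsupport hx]
  have s2 : HasCompactSupport fun x => ψ x w :=
    HasCompactSupport.intro h2' fun x hx => by simp [image_eq_zero_of_notMem_tsupport hx]
  have k1 : Continuous fun x => fderiv ℝ (fun x => φ x v) x e :=
    (c1.continuous_fderiv (by simp)).clm_apply continuous_const
  have k2 : Continuous fun x => fderiv ℝ (fun x => ψ x w) x e :=
    (c2.continuous_fderiv (by simp)).clm_apply continuous_const
  have i1 : Integrable fun x => fderiv ℝ (fun x => φ x v) x e * ψ x w :=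
    (k1.mul c2.continuous).integrable_of_hasCompactSupport s2.mul_left
  have i2 : Integrable fun x => φ x v * fderiv ℝ (fun x => ψ x w) x e :=
    (c1.continuous.mul k2).integrable_of_hasCompactSupport s1.mul_right
  have i3 : Integrable fun x => φ x v * ψ x w :=
    (c1.continuous.mul c2.continuous).integrable_of_hasCompactSupport s1.mul_right
  have key := integral_mul_fderiv_eq_neg_fderiv_mul_of_integrable i1 i2 i3
    (fun x _ => c1.differentiable (by simp) x) (fun x _ => c2.differentiable (by simp) x)
  simp only [d1, d2] at i1 i2 key
  exact ⟨i1.add i2, by rw [integral_add i1 i2, key]; ring⟩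

/-- `∫ d(φ ∧ ψ) = 0` for smooth compactly supported forms. -/
theorem integral_wedge_extDeriv_eq_zero {n m k : ℕ} (h : m + k + 1 = n) {φ : E n → Alt n m}
    {ψ : E n → Alt n k} (h1 : ContDiff ℝ ∞ φ) (h2 : HasCompactSupport φ) (h1' : ContDiff ℝ ∞ ψ)
    (h2' : HasCompactSupport ψ) :
    ∫ x, (wedgeTop (by omega : (m + 1) + k = n) (extDeriv φ x) (ψ x) +
      (-1) ^ m * wedgeTop (by omega : m + (k + 1) = n) (φ x) (extDeriv ψ x)) = 0 := by
  -- With the dimension literally `m + k + 1`, both halves expand over the same permutations with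
  -- the same constant, and the summands combine by the product rule.
  subst h
  simp_rw [wedgeTop_extDeriv_left, wedgeTop_extDeriv_right, ← mul_add, ← Finset.sum_add_distrib,
    ← mul_add]
  rw [integral_const_mul, integral_finsetSum]
  · simp [integral_const_mul, (integral_fderiv_component_mul h1 h2 h1' h2' _ _ _).2]
  · exact fun σ _ => (integral_fderiv_component_mul h1 h2 h1' h2' _ _ _).1.const_mul _

/-! ### Continuity of the Green form -/

/-- The integral is a finite signed sum of L² inner products of components, and taking a component
is a bounded operator on L². -/
theorem continuous_integral_wedgeTop {n k l : ℕ} (h : k + l = n) {U : Set (E n)} :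
    Continuous fun z : L2Form U k × L2Form U l => ∫ x in U, wedgeTop h (z.1 x) (z.2 x) := by
  let A : Equiv.Perm (Fin n) → Alt n k →L[ℝ] ℝ := fun σ => ContinuousAlternatingMap.apply ℝ (E n) ℝ
    (fun c => stdVec (σ (Fin.cast h (Fin.castAdd l c))))
  let B : Equiv.Perm (Fin n) → Alt n l →L[ℝ] ℝ := fun σ => ContinuousAlternatingMap.apply ℝ (E n) ℝ
    (fun c => stdVec (σ (Fin.cast h (Fin.natAdd k c))))
  have key : ∀ z : L2Form U k × L2Form U l, ∫ x in U, wedgeTop h (z.1 x) (z.2 x) =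
      (1 / ((k.factorial : ℝ) * (l.factorial : ℝ))) * ∑ σ : Equiv.Perm (Fin n),
        ((Equiv.Perm.sign σ : ℤ) : ℝ) *
          inner ℝ ((A σ).compLpL 2 (volume.restrict U) z.1)
            ((B σ).compLpL 2 (volume.restrict U) z.2) := by
    intro z
    have hae : ∀ σ, (fun x => inner ℝ ((A σ).compLpL 2 (volume.restrict U) z.1 x)
        ((B σ).compLpL 2 (volume.restrict U) z.2 x)) =ᵐ[volume.restrict U]
        fun x => A σ (z.1 x) * B σ (z.2 x) := by
      intro σ
      filter_upwards [(A σ).coeFn_compLpL (p := 2) (μ := volume.restrict U) z.1,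
        (B σ).coeFn_compLpL (p := 2) (μ := volume.restrict U) z.2] with x h1 h2
      rw [h1, h2]
      simp [mul_comm]
    have hint : ∀ σ, Integrable (fun x => A σ (z.1 x) * B σ (z.2 x)) (volume.restrict U) :=
      fun σ => (L2.integrable_inner _ _).congr (hae σ)
    simp_rw [L2.inner_def, fun σ => integral_congr_ae (hae σ), ← integral_const_mul]
    rw [← integral_finsetSum _ fun σ _ => (hint σ).const_mul _, ← integral_const_mul]
    refine integral_congr_ae (.of_forall fun x => ?_)
    simp only [wedgeTop, mul_assoc]
    rfl
  simp_rw [key]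
  fun_prop

theorem greenForm_eq_add {n k l : ℕ} (h : k + l + 1 = n) {U : Set (E n)} (v : L2Pair U k)
    (w : L2Pair U l) : greenForm h v w =
      (∫ x in U, wedgeTop (by omega : (k + 1) + l = n) (v.2 x) (w.1 x)) +
        (-1) ^ k * ∫ x in U, wedgeTop (by omega : k + (l + 1) = n) (v.1 x) (w.2 x) := by
  rw [greenForm, integral_add (integrable_wedgeTop _ _ _)
    ((integrable_wedgeTop _ _ _).const_mul _), integral_const_mul]

theorem continuous_greenForm {n k l : ℕ} (h : k + l + 1 = n) {U : Set (E n)} {X : Type*}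
    [TopologicalSpace X] {v : X → L2Pair U k} {w : X → L2Pair U l} (hv : Continuous v)
    (hw : Continuous w) : Continuous fun x => greenForm h (v x) (w x) := by
  simp_rw [greenForm_eq_add]
  have h1 := (continuous_integral_wedgeTop (U := U) (by omega : (k + 1) + l = n)).comp
    ((continuous_snd.comp hv).prodMk (continuous_fst.comp hw))
  have h2 := (continuous_integral_wedgeTop (U := U) (by omega : k + (l + 1) = n)).comp
    ((continuous_fst.comp hv).prodMk (continuous_snd.comp hw))
  exact h1.add (h2.const_mul _)

/-- Green's formula for smooth forms with compact support in `U`. -/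
theorem greenForm_smoothForms {n m k : ℕ} (h : m + k + 1 = n) {U : Set (E n)} {z : L2Pair U m}
    {w : L2Pair U k} (hz : z ∈ smoothForms U U m) (hw : w ∈ smoothForms U U k) :
    greenForm h z w = 0 := by
  obtain ⟨φ, h1, h2, h3, h4, h5⟩ := hz
  obtain ⟨ψ, h1', h2', h3', h4', h5'⟩ := hw
  rw [← integral_wedge_extDeriv_eq_zero h h1 h2 h1' h2',
    ← setIntegral_eq_integral_of_forall_compl_eq_zero (s := U)]
  · refine integral_congr_ae ?_
    filter_upwards [h4, h5, h4', h5'] with x a b c d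
    simp only [a, b, c, d]
  · intro x hx
    -- The support of φ alone already lets the integral be extended from `U` to the whole space.
    have hx' : x ∉ tsupport φ := fun hmem => hx (h3 hmem)
    rw [extDeriv_eq_zero hx', image_eq_zero_of_notMem_tsupport hx', wedgeTop_zero_left,
      wedgeTop_zero_left, mul_zero, add_zero]

/-- Each test form imposes one continuous linear condition. -/
theorem isClosed_graphD {n : ℕ} (U : Set (E n)) (k : ℕ) :
    IsClosed (graphD U k : Set (L2Pair U k)) := by
  have : (graphD U k : Set (L2Pair U k)) = ⋂ (m : ℕ) (h : m + k + 1 = n) (φ ∈ smoothForms U U m),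
      {w | greenForm h φ w = 0} := by
    ext w
    simp [graphD]
  rw [this]
  exact isClosed_iInter fun m => isClosed_iInter fun h => isClosed_iInter fun φ =>
    isClosed_iInter fun _ => isClosed_eq
      (continuous_greenForm h continuous_const continuous_id) continuous_const

/-- This guarantees that a limit of smooth compactly supported pairs is a genuine element of `HForm
U k`; it is where Stokes' theorem enters. -/
theorem topologicalClosure_smoothForms_le_graphD {n : ℕ} (U : Set (E n)) (k : ℕ) :
    (smoothForms U U k).topologicalClosure ≤ graphD U k :=
  Submodule.topologicalClosure_minimal _
    (fun _ hw _ h _ hφ => greenForm_smoothForms h hφ hw) (isClosed_graphD U k)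

/-- Forms in `H̊Ωᵏ(U)` have no boundary contribution in Green's formula. -/
theorem greenForm_HForm0 {n k l : ℕ} (h : k + l + 1 = n) {U : Set (E n)} {v : HForm U k}
    (hv : v ∈ HForm0 U k) (w : HForm U l) :
    greenForm h (HForm.pair U k v) (HForm.pair U l w) = 0 := by
  have hcl : IsClosed {z : L2Pair U k | greenForm h z (HForm.pair U l w) = 0} :=
    isClosed_eq (continuous_greenForm h continuous_id continuous_const) continuous_const
  -- For smooth `z` the identity is the very definition of the distributional derivative of `w`.
  exact closure_minimal (fun z hz => w.2 k h z hz) hcl hv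

/-- Green's formula applies to every representative, so the choice made in `bdryDual` is immaterial
here. -/
theorem bdryDual_HForm0 {n k l : ℕ} (h : k + l + 1 = n) {U Γ : Set (E n)} {v : HForm U k}
    (hv : v ∈ HForm0 U k) (u : TraceSpaceOn U Γ l) : bdryDual h v u = 0 :=
  greenForm_HForm0 h hv _

theorem smoothForms_mono {n : ℕ} {U S S' : Set (E n)} (hS : S ⊆ S') (k : ℕ) :
    smoothForms U S k ≤ smoothForms U S' k := by
  rintro z ⟨φ, h1, h2, h3, h⟩
  exact ⟨φ, h1, h2, h3.trans hS, h⟩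

/-- Forms in `H̊Ωᵏ(U)` have vanishing trace on every part of the boundary. -/
theorem HForm0_le_HFormVanishing {n : ℕ} {U Γ : Set (E n)} (hU : IsOpen U) (hΓ : Γ ⊆ frontier U)
    (k : ℕ) : HForm0 U k ≤ HFormVanishing U Γ k := by
  refine Submodule.comap_mono (Submodule.topologicalClosure_mono (smoothForms_mono ?_ k))
  -- The closure of Γ stays in the frontier, which the open set `U` does not meet.
  intro x hx hxΓ
  have := closure_minimal hΓ isClosed_frontier hxΓ
  rw [hU.frontier_eq] at this
  exact this.2 hx

/-! ### Extension by zero -/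

theorem HForm.pair_injective {n : ℕ} (U : Set (E n)) (k : ℕ) :
    Function.Injective (HForm.pair U k) :=
  (graphD U k).injective_subtype

theorem ae_restrict_indicator {n : ℕ} {T U : Set (E n)} (hT : MeasurableSet T) (hTU : T ⊆ U)
    {p : E n → Prop} (h : ∀ᵐ x ∂volume.restrict T, p x) :
    ∀ᵐ x ∂volume.restrict U, x ∈ T → p x := by
  rw [← inter_eq_left.2 hTU, ← Measure.restrict_restrict hT] at h
  exact (ae_restrict_iff' hT).1 h

section extension

variable {n : ℕ} {F : Type*} [NormedAddCommGroup F] {T U : Set (E n)}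

theorem memLp_indicator_of_subset (hT : MeasurableSet T) (hTU : T ⊆ U)
    (θ : Lp F 2 (volume.restrict T)) : MemLp (T.indicator θ) 2 (volume.restrict U) := by
  rw [memLp_indicator_iff_restrict hT, Measure.restrict_restrict hT, inter_eq_left.2 hTU]
  exact Lp.memLp θ

/-- Extension by zero `L²(T) → L²(U)` for `T ⊆ U`. -/
def extendLp [NormedSpace ℝ F] (hT : MeasurableSet T) (hTU : T ⊆ U) :
    Lp F 2 (volume.restrict T) →ₗᵢ[ℝ] Lp F 2 (volume.restrict U) where
  toFun θ := (memLp_indicator_of_subset hT hTU θ).toLp _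
  map_add' θ η := by
    rw [← MemLp.toLp_add]
    refine MemLp.toLp_congr _ _ ?_
    filter_upwards [ae_restrict_indicator hT hTU (Lp.coeFn_add θ η)] with x hx
    by_cases hxT : x ∈ T
    · rw [Pi.add_apply, indicator_of_mem hxT, indicator_of_mem hxT, indicator_of_mem hxT, hx hxT,
        Pi.add_apply]
    · simp [hxT]
  map_smul' c θ := by
    rw [RingHom.id_apply, ← MemLp.toLp_const_smul]
    refine MemLp.toLp_congr _ _ ?_
    filter_upwards [ae_restrict_indicator hT hTU (Lp.coeFn_smul c θ)] with x hx
    by_cases hxT : x ∈ T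
    · rw [Pi.smul_apply, indicator_of_mem hxT, indicator_of_mem hxT, hx hxT, Pi.smul_apply]
    · simp [hxT]
  norm_map' θ := by
    simp only [LinearMap.coe_mk, AddHom.coe_mk]
    rw [Lp.norm_toLp, Lp.norm_def, eLpNorm_indicator_eq_eLpNorm_restrict hT,
      Measure.restrict_restrict hT, inter_eq_left.2 hTU]

theorem coeFn_extendLp [NormedSpace ℝ F] (hT : MeasurableSet T) (hTU : T ⊆ U)
    (θ : Lp F 2 (volume.restrict T)) :
    extendLp hT hTU θ =ᵐ[volume.restrict U] T.indicator θ :=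
  (memLp_indicator_of_subset hT hTU θ).coeFn_toLp

end extension

/-- Extension by zero `L²Ωᵏ(T) → L²Ωᵏ(U)` for `T ⊆ U`. -/
def extendL2 {n : ℕ} {T U : Set (E n)} (hT : MeasurableSet T) (hTU : T ⊆ U) (k : ℕ) :
    L2Form T k →ₗᵢ[ℝ] L2Form U k :=
  extendLp hT hTU

theorem coeFn_extendL2 {n k : ℕ} {T U : Set (E n)} (hT : MeasurableSet T) (hTU : T ⊆ U)
    (θ : L2Form T k) : extendL2 hT hTU k θ =ᵐ[volume.restrict U] T.indicator θ :=
  coeFn_extendLp hT hTU θ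

theorem restrictL2_extendL2 {n k : ℕ} {T U : Set (E n)} (hT : MeasurableSet T) (hTU : T ⊆ U)
    (θ : L2Form T k) : restrictL2 hTU k (extendL2 hT hTU k θ) = θ := by
  refine Lp.ext ?_
  filter_upwards [coeFn_restrictL2 hTU (extendL2 hT hTU k θ),
    ae_restrict_of_ae_restrict_of_subset hTU (coeFn_extendL2 hT hTU θ), ae_restrict_mem hT]
    with x h1 h2 h3
  rw [h1, h2, indicator_of_mem h3]

theorem restrictL2_extendL2_of_disjoint {n k : ℕ} {T T' U : Set (E n)} (hT : MeasurableSet T)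
    (hTU : T ⊆ U) (hT' : MeasurableSet T') (hTU' : T' ⊆ U) (hd : Disjoint T T')
    (θ : L2Form T k) : restrictL2 hTU' k (extendL2 hT hTU k θ) = 0 := by
  refine Lp.ext ?_
  filter_upwards [coeFn_restrictL2 hTU' (extendL2 hT hTU k θ),
    ae_restrict_of_ae_restrict_of_subset hTU' (coeFn_extendL2 hT hTU θ), ae_restrict_mem hT',
    Lp.coeFn_zero (Alt n k) 2 (volume.restrict T')] with x h1 h2 h3 h4
  rw [h1, h2, h4, indicator_of_notMem (hd.notMem_of_mem_right h3), Pi.zero_apply]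

/-- The same φ serves on `U`: its support lies in `T`, so φ and its derivative vanish on the rest.
-/
theorem extendL2_mem_smoothForms {n k : ℕ} {T U : Set (E n)} (hT : MeasurableSet T) (hTU : T ⊆ U)
    {z : L2Pair T k} (hz : z ∈ smoothForms T T k) :
    (extendL2 hT hTU k z.1, extendL2 hT hTU (k + 1) z.2) ∈ smoothForms U U k := by
  obtain ⟨φ, h1, h2, h3, h4, h5⟩ := hz
  refine ⟨φ, h1, h2, h3.trans hTU, ?_, ?_⟩
  · filter_upwards [coeFn_extendL2 hT hTU z.1, ae_restrict_indicator hT hTU h4] with x a b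
    rw [a]
    by_cases hx : x ∈ T
    · rw [indicator_of_mem hx, b hx]
    · rw [indicator_of_notMem hx, image_eq_zero_of_notMem_tsupport fun hmem => hx (h3 hmem)]
  · filter_upwards [coeFn_extendL2 hT hTU z.2, ae_restrict_indicator hT hTU h5] with x a b
    rw [a]
    by_cases hx : x ∈ T
    · rw [indicator_of_mem hx, b hx]
    · rw [indicator_of_notMem hx, extDeriv_eq_zero fun hmem => hx (h3 hmem)]

/-- Extension by zero maps `H̊Ωᵏ(T)` to `H̊Ωᵏ(U)`. -/
theorem exists_extension_HForm0 {n k : ℕ} {T U : Set (E n)} (hT : MeasurableSet T) (hU : IsOpen U)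
    (hTU : T ⊆ U) {θ : HForm T k} (hθ : θ ∈ HForm0 T k) :
    ∃ η ∈ HForm0 U k, restrictH hU hTU k η = θ ∧
      ∀ T' (_ : MeasurableSet T') (hTU' : T' ⊆ U), Disjoint T T' →
        restrictH hU hTU' k η = 0 := by
  let F : L2Pair T k → L2Pair U k := Prod.map (extendL2 hT hTU k) (extendL2 hT hTU (k + 1))
  have hF : Continuous F := (extendL2 hT hTU k).continuous.prodMap (extendL2 hT hTU _).continuous
  -- Extension by zero is continuous on pairs, so it carries the closure of the smooth forms on `T`
  -- into the closure of those on `U`.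
  have hmem : F (HForm.pair T k θ) ∈ (smoothForms U U k).topologicalClosure :=
    map_mem_closure hF hθ fun z hz => extendL2_mem_smoothForms hT hTU hz
  refine ⟨⟨F (HForm.pair T k θ), topologicalClosure_smoothForms_le_graphD U k hmem⟩, hmem,
    HForm.pair_injective T k ?_, fun T' hT' hTU' hd => HForm.pair_injective T' k ?_⟩
  · exact Prod.ext (restrictL2_extendL2 hT hTU _) (restrictL2_extendL2 hT hTU _)
  · exact Prod.ext (restrictL2_extendL2_of_disjoint hT hTU hT' hTU' hd _)
      (restrictL2_extendL2_of_disjoint hT hTU hT' hTU' hd _)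

/-! ### Gluing elementwise forms over the mesh -/

variable {n : ℕ} {M : Set (E n)} {ι : Type}

/-- A broken form with vanishing traces on all element boundaries is a form in `H̊Ωᵏ(M)`. -/
theorem exists_restrictB_of_trBroken_eq_zero [Fintype ι] {𝒯 : Mesh M ι} {k : ℕ} {θ : Broken 𝒯 k}
    (hθ : trBroken 𝒯 k θ = 0) : ∃ η ∈ HForm0 M k, restrictB 𝒯 k η = θ := by
  classical
  have hθ' : ∀ i, θ i ∈ HForm0 (𝒯.T i) k := fun i =>
    (Submodule.Quotient.mk_eq_zero _).1 (congrFun hθ i)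
  choose η hη h1 h2 using fun i => exists_extension_HForm0 (𝒯.lipschitz i).1.measurableSet
    𝒯.lipschitz_domain.1 (𝒯.subset i) (hθ' i)
  refine ⟨∑ i, η i, Submodule.sum_mem _ fun i _ => hη i, ?_⟩
  ext1 j
  change restrictH 𝒯.lipschitz_domain.1 (𝒯.subset j) k (∑ i, η i) = θ j
  -- Only the extension from element `j` survives on it, the elements being disjoint.
  rw [map_sum, Finset.sum_eq_single j, h1]
  · exact fun i _ hij => h2 i _ (𝒯.lipschitz j).1.measurableSet (𝒯.subset j) (𝒯.disjoint hij)
  · simp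

theorem eq_zero_of_restrictL2_eq_zero [Fintype ι] (𝒯 : Mesh M ι) {k : ℕ} {θ : L2Form M k}
    (h : ∀ i, restrictL2 (𝒯.subset i) k θ = 0) : θ = 0 := by
  have h0 : ∀ i, ∀ᵐ x ∂volume.restrict (𝒯.T i), θ x = 0 := fun i => by
    filter_upwards [coeFn_restrictL2 (𝒯.subset i) θ,
      Lp.coeFn_zero (Alt n k) 2 (volume.restrict (𝒯.T i))] with x h1 h2
    rw [← h1, h i, h2, Pi.zero_apply]
  have hU : ∀ᵐ x ∂volume.restrict (⋃ i, 𝒯.T i), θ x = 0 :=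
    (ae_restrict_iUnion_iff _ _).2 h0
  have hM : ∀ᵐ x ∂volume.restrict M, θ x = 0 := by
    refine ae_mono ?_ (ae_restrict_of_ae_restrict_of_subset subset_rfl hU)
    -- The part of `M` outside the elements is null, so an almost everywhere statement on their
    -- union holds on `M`.
    refine (Measure.restrict_mono_ae ?_)
    rw [ae_le_set]
    exact 𝒯.cover
  refine Lp.ext ?_
  filter_upwards [hM, Lp.coeFn_zero (Alt n k) 2 (volume.restrict M)] with x h1 h2
  rw [h1, h2, Pi.zero_apply]

theorem restrictB_injective [Fintype ι] (𝒯 : Mesh M ι) (k : ℕ) :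
    Function.Injective (restrictB 𝒯 k) := by
  rw [injective_iff_map_eq_zero]
  intro η hη
  have h : ∀ i, HForm.pair _ k (restrictH 𝒯.lipschitz_domain.1 (𝒯.subset i) k η) = 0 := fun i =>
    (congrArg (HForm.pair _ k) (congrFun hη i)).trans (map_zero _)
  refine HForm.pair_injective M k ?_
  rw [map_zero]
  exact Prod.ext (eq_zero_of_restrictL2_eq_zero 𝒯 fun i => congrArg Prod.fst (h i))
    (eq_zero_of_restrictL2_eq_zero 𝒯 fun i => congrArg Prod.snd (h i))

/-! ### Linearity of the broken inner product -/

theorem RiemannianMetric.continuousOn_g (g : RiemannianMetric M) : ContinuousOn g.g g.nhd :=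
  continuousOn_pi.2 fun i => continuousOn_pi.2 fun j => (g.smooth i j).continuousOn

theorem RiemannianMetric.continuousOn_det (g : RiemannianMetric M) :
    ContinuousOn (fun x => (g.g x).det) g.nhd :=
  (continuous_id.matrix_det).comp_continuousOn g.continuousOn_g

theorem RiemannianMetric.continuousOn_inv (g : RiemannianMetric M) (i j : Fin n) :
    ContinuousOn (fun x => (g.g x)⁻¹ i j) g.nhd := by
  have h1 : ContinuousOn (fun x => (g.g x).adjugate i j) g.nhd :=
    ((continuous_id.matrix_adjugate).matrix_elem i j).comp_continuousOn g.continuousOn_g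
  have h2 : ContinuousOn (fun x => (g.g x).det⁻¹) g.nhd :=
    g.continuousOn_det.inv₀ fun x hx => (g.posDef x hx).det_pos.ne'
  refine (h2.mul h1).congr fun x _ => ?_
  simp [Matrix.inv_def, Ring.inverse_eq_inv']

/-- The metric coefficients are continuous on the compact closure of `M`, hence bounded, and a
product of two L² components is integrable. This is what makes the broken inner product additive. -/
theorem integrable_fiberInner {k : ℕ} (g : RiemannianMetric M) (hM : Bornology.IsBounded M)
    {T : Set (E n)} (hT : MeasurableSet T) (hTM : T ⊆ M) (θ η : L2Form T k) :
    Integrable (fun x => fiberInner (g.g x) (θ x) (η x) * Real.sqrt (g.g x).det)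
      (volume.restrict T) := by
  have key : ∀ i j : Fin k → Fin n, Integrable (fun x =>
      ((∏ c, (g.g x)⁻¹ (i c) (j c)) * Real.sqrt (g.g x).det) *
        (θ x (fun c => stdVec (i c)) * η x (fun c => stdVec (j c)))) (volume.restrict T) := by
    intro i j
    have hc : ContinuousOn (fun x => (∏ c, (g.g x)⁻¹ (i c) (j c)) * Real.sqrt (g.g x).det)
        (closure M) :=
      ((continuousOn_finsetProd _ fun c _ => g.continuousOn_inv (i c) (j c)).mul
        (Real.continuous_sqrt.comp_continuousOn g.continuousOn_det)).mono g.closure_subset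
    obtain ⟨C, hC⟩ := hM.isCompact_closure.exists_bound_of_continuousOn hc
    have ha : MemLp (fun x => θ x (fun c => stdVec (i c))) 2 (volume.restrict T) :=
      (ContinuousAlternatingMap.apply ℝ (E n) ℝ (fun c => stdVec (i c))).comp_memLp' (Lp.memLp θ)
    have hb : MemLp (fun x => η x (fun c => stdVec (j c))) 2 (volume.restrict T) :=
      (ContinuousAlternatingMap.apply ℝ (E n) ℝ (fun c => stdVec (j c))).comp_memLp' (Lp.memLp η)
    refine (MemLp.integrable_mul ha hb).bdd_mul (c := C)
      ((hc.mono (hTM.trans subset_closure)).aestronglyMeasurable hT) ?_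
    filter_upwards [ae_restrict_mem hT] with x hx
    exact hC x (subset_closure (hTM hx))
  have := (integrable_finsetSum Finset.univ fun i _ =>
    integrable_finsetSum Finset.univ fun j _ => key i j).const_mul (1 / (k.factorial : ℝ))
  refine this.congr (.of_forall fun x => ?_)
  simp only [fiberInner, Finset.mul_sum, Finset.sum_mul]
  exact Finset.sum_congr rfl fun i _ => Finset.sum_congr rfl fun j _ => by ring

theorem fiberInner_add_left {k : ℕ} (G : Matrix (Fin n) (Fin n) ℝ) (a a' b : Alt n k) :
    fiberInner G (a + a') b = fiberInner G a b + fiberInner G a' b := by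
  simp [fiberInner, mul_add, add_mul, Finset.sum_add_distrib]

theorem fiberInner_smul_left {k : ℕ} (G : Matrix (Fin n) (Fin n) ℝ) (r : ℝ) (a b : Alt n k) :
    fiberInner G (r • a) b = r * fiberInner G a b := by
  simp only [fiberInner, ContinuousAlternatingMap.smul_apply, smul_eq_mul, Finset.mul_sum]
  exact Finset.sum_congr rfl fun i _ => Finset.sum_congr rfl fun j _ => by ring

/-- The functional `θ ↦ (θ, η)_{𝒯_h}`. -/
def brokenInnerLeft [Fintype ι] (g : RiemannianMetric M) {𝒯 : Mesh M ι} {k : ℕ}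
    (η : ∀ i, L2Form (𝒯.T i) k) : (∀ i, L2Form (𝒯.T i) k) →ₗ[ℝ] ℝ where
  toFun θ := brokenInner g θ η
  map_add' θ θ' := by
    simp only [brokenInner, ← Finset.sum_add_distrib, l2Inner]
    refine Finset.sum_congr rfl fun i _ => ?_
    have hint := fun ζ : L2Form (𝒯.T i) k => integrable_fiberInner g 𝒯.lipschitz_domain.2.1
      (𝒯.lipschitz i).1.measurableSet (𝒯.subset i) ζ (η i)
    rw [← integral_add (hint _) (hint _)]
    refine integral_congr_ae ?_
    filter_upwards [Lp.coeFn_add (θ i) (θ' i)] with x hx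
    rw [Pi.add_apply, hx, Pi.add_apply, fiberInner_add_left, add_mul]
  map_smul' c θ := by
    simp only [brokenInner, Finset.mul_sum, l2Inner, RingHom.id_apply, smul_eq_mul]
    refine Finset.sum_congr rfl fun i _ => ?_
    rw [← integral_const_mul]
    refine integral_congr_ae ?_
    filter_upwards [Lp.coeFn_smul c (θ i)] with x hx
    rw [Pi.smul_apply, hx, Pi.smul_apply, fiberInner_smul_left, mul_assoc]

/-- The underlying `L²` form of a broken form, as a linear map. -/
def Broken.valₗ (𝒯 : Mesh M ι) (k : ℕ) : Broken 𝒯 k →ₗ[ℝ] ∀ i, L2Form (𝒯.T i) k :=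
  LinearMap.pi fun i => LinearMap.fst ℝ _ _ ∘ₗ HForm.pair (𝒯.T i) k ∘ₗ LinearMap.proj i

/-- The elementwise exterior derivative, as a linear map. -/
def Broken.dₗ (𝒯 : Mesh M ι) (k : ℕ) : Broken 𝒯 k →ₗ[ℝ] ∀ i, L2Form (𝒯.T i) (k + 1) :=
  LinearMap.pi fun i => LinearMap.snd ℝ _ _ ∘ₗ HForm.pair (𝒯.T i) k ∘ₗ LinearMap.proj i

/-! ### Conforming and broken spaces -/

section conforming

variable {𝒯 : Mesh M ι} {D : FESpaces 𝒯} {k : ℕ}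

theorem trW_surjective (D : FESpaces 𝒯) (k : ℕ) : Function.Surjective (trW D k) :=
  LinearMap.submoduleMap_surjective _ _

/-- The normal traces form the full dual of `Wt`, so they separate points. -/
theorem eq_of_forall_normalTrace {x y : Wt D k} (h : ∀ ν : Wn D k, ν (x - y) = 0) : x = y :=
  sub_eq_zero.1 ((Module.forall_dual_apply_eq_zero_iff ℝ _).1 h)

theorem mem_VhVanishing_of_mem_HForm0 {Γ : Set (E n)} (hΓ : Γ ⊆ frontier M) {c : Vh D k}
    (hc : c.1 ∈ HForm0 M k) : c ∈ VhVanishing D Γ k :=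
  HForm0_le_HFormVanishing 𝒯.lipschitz_domain.1 hΓ k hc

variable [Fintype ι]

theorem finiteDimensional_Wh (D : FESpaces 𝒯) (k : ℕ) : FiniteDimensional ℝ (Wh D k) := by
  have := fun i => D.finite k i
  let f : Wh D k →ₗ[ℝ] ∀ i, D.W k i :=
    LinearMap.pi fun i => (LinearMap.proj i).restrict fun x hx => hx i (mem_univ i)
  refine FiniteDimensional.of_injective f fun x y hxy => Subtype.ext (funext fun i => ?_)
  exact congrArg Subtype.val (congrFun hxy i)

theorem toBroken_injective (D : FESpaces 𝒯) (k : ℕ) : Function.Injective (toBroken D k) :=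
  fun _ _ h => Subtype.ext (restrictB_injective 𝒯 k (congrArg Subtype.val h))

/-- A continuous left inverse of the inclusion `V_hᵏ ↪ W_hᵏ`. -/
theorem exists_leftInverse_toBroken (D : FESpaces 𝒯) (k : ℕ) :
    ∃ L : Wh D k →L[ℝ] Vh D k, ∀ v, L (toBroken D k v) = v := by
  have := finiteDimensional_Wh D k
  obtain ⟨L, hL⟩ := (toBroken D k).exists_leftInverse_of_injective
    (LinearMap.ker_eq_bot.2 (toBroken_injective D k))
  exact ⟨LinearMap.toContinuousLinearMap L, fun v => LinearMap.congr_fun hL v⟩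

/-- The inclusion `V_hᵏ ↪ W_hᵏ` is continuous. -/
theorem exists_continuous_toBroken (D : FESpaces 𝒯) (k : ℕ) :
    ∃ L : Vh D k →L[ℝ] Wh D k, ∀ v, L v = toBroken D k v := by
  have := finiteDimensional_Wh D k
  have : FiniteDimensional ℝ (Vh D k) :=
    FiniteDimensional.of_injective (toBroken D k) (toBroken_injective D k)
  exact ⟨LinearMap.toContinuousLinearMap (toBroken D k), fun v => rfl⟩

/-- `Vh` and `Wh` carry different norms, but the inclusion and a left inverse of it are both
continuous, so differentiability transfers either way. -/
theorem differentiableOn_conforming_iff {I : Set ℝ} {b : ℝ → Wh D k} {c : ℝ → Vh D k}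
    (h : ∀ t ∈ I, toBroken D k (c t) = b t) : DifferentiableOn ℝ c I ↔ DifferentiableOn ℝ b I := by
  constructor
  · obtain ⟨L, hL⟩ := exists_continuous_toBroken D k
    exact fun hc => (L.differentiable.comp_differentiableOn hc).congr fun t ht => by
      rw [← h t ht, Function.comp_apply, hL]
  · obtain ⟨L, hL⟩ := exists_leftInverse_toBroken D k
    exact fun hb => (L.differentiable.comp_differentiableOn hb).congr fun t ht => by
      rw [Function.comp_apply, ← h t ht, hL]

/-- A continuous linear map commutes with the derivative; unique differentiability of `I` turns this
into an equality of `derivWithin`. -/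
theorem toBroken_derivWithin {I : Set ℝ} {b : ℝ → Wh D k} {c : ℝ → Vh D k}
    (h : ∀ t ∈ I, toBroken D k (c t) = b t) (hc : DifferentiableOn ℝ c I) {t : ℝ} (ht : t ∈ I)
    (hI : UniqueDiffOn ℝ I) :
    toBroken D k (derivWithin c I t) = derivWithin b I t := by
  obtain ⟨L, hL⟩ := exists_continuous_toBroken D k
  have h1 : HasDerivWithinAt (fun τ => L (c τ)) (L (derivWithin c I t)) I t :=
    L.hasFDerivAt.comp_hasDerivWithinAt t (hc t ht).hasDerivWithinAt
  have h2 : HasDerivWithinAt b (L (derivWithin c I t)) I t :=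
    h1.congr (fun τ hτ => by rw [hL, h τ hτ]) (by rw [hL, h t ht])
  rw [← hL, h2.derivWithin (hI t ht)]

/-- A finite element form with vanishing traces on all element boundaries is conforming, with
vanishing boundary trace. -/
theorem exists_conforming_of_trW_eq_zero {b : Wh D k} (hb : trW D k b = 0) :
    ∃ c : Vh D k, c.1 ∈ HForm0 M k ∧ toBroken D k c = b := by
  obtain ⟨η, hη, h⟩ := exists_restrictB_of_trBroken_eq_zero (congrArg Subtype.val hb)
  exact ⟨⟨η, by rw [Vh, Submodule.mem_comap, h]; exact b.2⟩, hη, Subtype.ext h⟩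

/-- Finite element forms with single valued traces are conforming. -/
theorem exists_conforming_of_trW_mem_Vt {b : Wh D k} (hb : trW D k b ∈ Vt D k) :
    ∃ c : Vh D k, toBroken D k c = b := by
  obtain ⟨w, hw⟩ := hb
  -- Subtracting a conforming form with the same facet trace leaves a form with zero trace on every
  -- element boundary.
  obtain ⟨c, -, hc⟩ := exists_conforming_of_trW_eq_zero (b := b - toBroken D k w)
    (by rw [map_sub, ← hw]; exact sub_self _)
  exact ⟨c + w, by rw [map_add, hc, sub_add_cancel]⟩

/-- The boundary condition on a facet trace does not depend on the conforming form representing it: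
two representatives differ by an element of `HForm0 M k`, whose trace on Γ is zero. -/
theorem facetRestrictsTo_trV_iff {Γ : Set (E n)} (hΓ : Γ ⊆ frontier M) {a : ℝ} {c : Vh D k}
    {u : TraceSpaceOn M Γ k} :
    FacetRestrictsTo a (trV D k c) u ↔ a • trOn M Γ k c.1 = u := by
  refine ⟨?_, fun h => ⟨c, rfl, h⟩⟩
  rintro ⟨v, hv, rfl⟩
  obtain ⟨e, he, hec⟩ := exists_conforming_of_trW_eq_zero (b := toBroken D k (c - v))
    (by change trV D k (c - v) = 0; rw [map_sub, hv, sub_self])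
  rw [toBroken_injective D k hec] at he
  have : trOn M Γ k (c.1 - v.1) = 0 := (Submodule.Quotient.mk_eq_zero _).2
    (HForm0_le_HFormVanishing 𝒯.lipschitz_domain.1 hΓ k he)
  rw [map_sub, sub_eq_zero] at this
  rw [this]

/-- Functionals on `W_hᵏ` that vanish on forms without trace are uniquely represented by normal
traces. -/
theorem existsUnique_normalTrace (F : Wh D k →ₗ[ℝ] ℝ)
    (hF : ∀ c : Vh D k, c.1 ∈ HForm0 M k → F (toBroken D k c) = 0) :
    ∃! ν : Wn D k, ∀ v, ν (trW D k v) = F v := by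
  have hmem : F ∈ LinearMap.range (trW D k).dualMap := by
    -- Over a field, a functional factors through a linear map exactly when it kills the kernel.
    rw [LinearMap.range_dualMap_eq_dualAnnihilator_ker, Submodule.mem_dualAnnihilator]
    intro v hv
    obtain ⟨c, hc, rfl⟩ := exists_conforming_of_trW_eq_zero hv
    exact hF c hc
  obtain ⟨ν, hν⟩ := hmem
  refine ⟨ν, fun v => LinearMap.congr_fun hν v, fun ν' hν' => LinearMap.ext fun y => ?_⟩
  obtain ⟨v, rfl⟩ := trW_surjective D k y
  rw [hν' v, ← hν, LinearMap.dualMap_apply]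

end conforming

/-! ### Equivalence of the mixed and hybrid systems -/

section equivalence

variable [Fintype ι] {g : RiemannianMetric M} {𝒯 : Mesh M ι} {Dh D : FESpaces 𝒯}
  {Γ₁ Γ₂ : Set (E n)} {r s : ℕ} {h : r + s + 1 = n} {Tend : ℝ}
  {u₁ : ℝ → ControlSpace D Γ₁ s} {u₂ : ℝ → ControlSpace Dh Γ₂ r}

theorem IsBoundaryPartition.subset_left (hΓ : IsBoundaryPartition M Γ₁ Γ₂) : Γ₁ ⊆ frontier M :=
  subset_closure.trans (subset_union_left.trans hΓ.cover.subset)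

theorem IsBoundaryPartition.subset_right (hΓ : IsBoundaryPartition M Γ₁ Γ₂) : Γ₂ ⊆ frontier M :=
  subset_closure.trans (subset_union_right.trans hΓ.cover.subset)

theorem neg_one_pow_mul_self (m : ℕ) : (-1 : ℝ) ^ m * (-1) ^ m = 1 := by
  rw [← mul_pow]; simp

/-- The local equation tested with conforming functions and the facet balance `eq₄` add up to the
mixed equation; conversely, the balance is the difference of the mixed and the local equation. -/
theorem isHybridPrimal_iff (hΓ : Γ₂ ⊆ frontier M) (α : ℝ → Wh Dh (r + 1)) (β : ℝ → Wh Dh r)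
    (αn : ℝ → Wn Dh r) (βt : ℝ → Wt Dh r) :
    IsHybridPrimal g Dh D Γ₁ Γ₂ h Tend u₁ u₂ α β αn βt ↔
      (∃ βc : ℝ → Vh Dh r, (∀ t ∈ Ioc 0 Tend, toBroken Dh r (βc t) = β t) ∧
        IsMixedPrimal g Dh D Γ₁ Γ₂ h Tend u₁ u₂ α βc) ∧
      (∀ t ∈ Ioc 0 Tend, βt t = trW Dh r (β t)) ∧
      ∀ t ∈ Ioc 0 Tend, HybridPrimalEq₂ g Dh Tend α β t (αn t) := by
  have hI : UniqueDiffOn ℝ (Ioc 0 Tend) := uniqueDiffOn_Ioc 0 Tend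
  have hne : (-1 : ℝ) ^ (r + 1) ≠ 0 := pow_ne_zero _ (by norm_num)
  constructor
  · intro H
    have htr : ∀ t ∈ Ioc 0 Tend, βt t = trW Dh r (β t) := fun t ht =>
      (eq_of_forall_normalTrace fun ν => by
        simpa [hne] using (H.eq₃ t ht ν).symm).symm
    -- Outside the time interval nothing is known about `β t`, so the conforming lift is set to 0
    -- there.
    have hex : ∀ t, ∃ c : Vh Dh r, t ∈ Ioc 0 Tend → toBroken Dh r c = β t := fun t => by
      by_cases ht : t ∈ Ioc 0 Tend
      · obtain ⟨c, hc⟩ := exists_conforming_of_trW_mem_Vt (htr t ht ▸ H.mem_Vt t ht)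
        exact ⟨c, fun _ => hc⟩
      · exact ⟨0, fun h => absurd h ht⟩
    choose βc hβc using hex
    have hdiff := (differentiableOn_conforming_iff hβc).2 H.diff_β
    refine ⟨⟨βc, hβc, H.diff_α, hdiff, fun t ht => ?_, fun t ht v => ?_, fun t ht v hv => ?_⟩,
      htr, H.eq₂⟩
    · have := H.essential t ht
      rw [htr t ht, ← hβc t ht] at this
      exact (facetRestrictsTo_trV_iff hΓ).1 this
    · rw [hβc t ht]
      exact H.eq₁ t ht v
    · rw [toBroken_derivWithin hβc hdiff ht hI, H.eq₂ t ht (toBroken Dh r v)]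
      have h4 := H.eq₄ t ht v hv
      change 0 = (-1) ^ (r + 1) * (-αn t (trW Dh r (toBroken Dh r v)) + _) at h4
      linear_combination h4
  · rintro ⟨⟨βc, hβc, H⟩, htr, h2⟩
    have hmem : ∀ t ∈ Ioc 0 Tend, trV Dh r (βc t) = βt t := fun t ht => by
      rw [htr t ht, ← hβc t ht]; rfl
    refine ⟨H.diff_α, (differentiableOn_conforming_iff hβc).1 H.diff_β,
      fun t ht => ⟨βc t, hmem t ht⟩, fun t ht => ⟨βc t, hmem t ht, H.essential t ht⟩,
      fun t ht v => ?_, h2, fun t ht ν => ?_, fun t ht v hv => ?_⟩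
    · rw [← hβc t ht]
      exact H.eq₁ t ht v
    · rw [htr t ht, sub_self, map_zero, mul_zero]
    · have e1 := H.eq₂ t ht v hv
      rw [toBroken_derivWithin hβc H.diff_β ht hI] at e1
      have e2 := h2 t ht (toBroken Dh r v)
      change 0 = (-1) ^ (r + 1) * (-αn t (trW Dh r (toBroken Dh r v)) + _)
      linear_combination e1 - e2

theorem IsMixedPrimal.existsUnique_normalTrace (hΓ : Γ₂ ⊆ frontier M) {α : ℝ → Wh Dh (r + 1)}
    {β : ℝ → Vh Dh r} (H : IsMixedPrimal g Dh D Γ₁ Γ₂ h Tend u₁ u₂ α β) {t : ℝ}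
    (ht : t ∈ Ioc 0 Tend) :
    ∃! αn : Wn Dh r, HybridPrimalEq₂ g Dh Tend α (fun τ => toBroken Dh r (β τ)) t αn := by
  have hsq := neg_one_pow_mul_self (r + 1)
  have hder := toBroken_derivWithin (b := fun τ => toBroken Dh r (β τ)) (fun _ _ => rfl) H.diff_β ht
    (uniqueDiffOn_Ioc 0 Tend)
  -- This is the local equation solved for the normal trace term; since the sign squares to one, the
  -- equation says exactly that `αn` composed with `trW` is `F`.
  let F : Wh Dh r →ₗ[ℝ] ℝ :=
    ((-1 : ℝ) ^ (r + 1) • (brokenInnerLeft g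
        (derivWithin (fun τ => toBroken Dh r (β τ)) (Ioc 0 Tend) t).1.val ∘ₗ Broken.valₗ 𝒯 r) +
      brokenInnerLeft g (α t).1.val ∘ₗ Broken.dₗ 𝒯 r) ∘ₗ (Wh Dh r).subtype
  have hF : ∀ v, F v = (-1 : ℝ) ^ (r + 1) * brokenInner g v.1.val
      (derivWithin (fun τ => toBroken Dh r (β τ)) (Ioc 0 Tend) t).1.val +
      brokenInner g v.1.d (α t).1.val := fun v => rfl
  -- A form in `HForm0` has zero trace on Γ₂ and is therefore admissible in the mixed equation,
  -- where its boundary term drops out.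
  obtain ⟨ν, hν, huniq⟩ := PHHybrid.existsUnique_normalTrace F fun c hc => by
    have e := H.eq₂ t ht c (mem_VhVanishing_of_mem_HForm0 hΓ hc)
    rw [bdryDual_HForm0 h hc, hder] at e
    rw [hF, e]
    linear_combination -brokenInner g (toBroken Dh r c).1.d (α t).1.val * hsq
  refine ⟨ν, fun v => ?_, fun ν' hν' => huniq ν' fun v => ?_⟩
  · rw [hν v, hF]
    linear_combination -brokenInner g v.1.val
      (derivWithin (fun τ => toBroken Dh r (β τ)) (Ioc 0 Tend) t).1.val * hsq
  · rw [hF, hν' v]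
    linear_combination (brokenInner g v.1.d (α t).1.val - ν' (trW Dh r v)) * hsq

/-- The mechanism is that of the primal case, with Γ₁ carrying the essential condition and the input
on Γ₂ entering through the facet balance. -/
theorem isHybridDual_iff (hΓ : Γ₁ ⊆ frontier M) (α : ℝ → Wh D s) (β : ℝ → Wh D (s + 1))
    (βn : ℝ → Wn D s) (αt : ℝ → Wt D s) :
    IsHybridDual g Dh D Γ₁ Γ₂ h Tend u₁ u₂ α β βn αt ↔
      (∃ αc : ℝ → Vh D s, (∀ t ∈ Ioc 0 Tend, toBroken D s (αc t) = α t) ∧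
        IsMixedDual g Dh D Γ₁ Γ₂ h Tend u₁ u₂ αc β) ∧
      (∀ t ∈ Ioc 0 Tend, αt t = trW D s (α t)) ∧
      ∀ t ∈ Ioc 0 Tend, HybridDualEq₁ g D Tend α β t (βn t) := by
  have hI : UniqueDiffOn ℝ (Ioc 0 Tend) := uniqueDiffOn_Ioc 0 Tend
  constructor
  · intro H
    have htr : ∀ t ∈ Ioc 0 Tend, αt t = trW D s (α t) := fun t ht =>
      (eq_of_forall_normalTrace fun ν => (H.eq₃ t ht ν).symm).symm
    have hex : ∀ t, ∃ c : Vh D s, t ∈ Ioc 0 Tend → toBroken D s c = α t := fun t => by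
      by_cases ht : t ∈ Ioc 0 Tend
      · obtain ⟨c, hc⟩ := exists_conforming_of_trW_mem_Vt (htr t ht ▸ H.mem_Vt t ht)
        exact ⟨c, fun _ => hc⟩
      · exact ⟨0, fun h => absurd h ht⟩
    choose αc hαc using hex
    have hdiff := (differentiableOn_conforming_iff hαc).2 H.diff_α
    refine ⟨⟨αc, hαc, hdiff, H.diff_β, fun t ht => ?_, fun t ht v hv => ?_, fun t ht v => ?_⟩,
      htr, H.eq₁⟩
    · have := H.essential t ht
      rw [htr t ht, ← hαc t ht] at this
      rw [← (facetRestrictsTo_trV_iff hΓ).1 this, one_smul]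
    · rw [toBroken_derivWithin hαc hdiff ht hI, H.eq₁ t ht (toBroken D s v)]
      have h4 := H.eq₄ t ht v hv
      change 0 = βn t (trW D s (toBroken D s v)) + _ at h4
      linear_combination h4
    · rw [hαc t ht]
      exact H.eq₂ t ht v
  · rintro ⟨⟨αc, hαc, H⟩, htr, h1⟩
    have hmem : ∀ t ∈ Ioc 0 Tend, trV D s (αc t) = αt t := fun t ht => by
      rw [htr t ht, ← hαc t ht]; rfl
    refine ⟨(differentiableOn_conforming_iff hαc).1 H.diff_α, H.diff_β,
      fun t ht => ⟨αc t, hmem t ht⟩,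
      fun t ht => ⟨αc t, hmem t ht, by rw [one_smul, H.essential t ht]⟩,
      h1, fun t ht v => ?_, fun t ht ν => ?_, fun t ht v hv => ?_⟩
    · rw [← hαc t ht]
      exact H.eq₂ t ht v
    · rw [htr t ht, sub_self, map_zero]
    · have e1 := H.eq₁ t ht v hv
      rw [toBroken_derivWithin hαc H.diff_α ht hI] at e1
      have e2 := h1 t ht (toBroken D s v)
      change 0 = βn t (trW D s (toBroken D s v)) + _
      linear_combination e1 - e2

theorem IsMixedDual.existsUnique_normalTrace (hΓ : Γ₁ ⊆ frontier M) {α : ℝ → Vh D s}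
    {β : ℝ → Wh D (s + 1)} (H : IsMixedDual g Dh D Γ₁ Γ₂ h Tend u₁ u₂ α β) {t : ℝ}
    (ht : t ∈ Ioc 0 Tend) :
    ∃! βn : Wn D s, HybridDualEq₁ g D Tend (fun τ => toBroken D s (α τ)) β t βn := by
  have hder := toBroken_derivWithin (b := fun τ => toBroken D s (α τ)) (fun _ _ => rfl) H.diff_α ht
    (uniqueDiffOn_Ioc 0 Tend)
  -- The local equation solved for the `βn` term; no sign has to be inverted here.
  let F : Wh D s →ₗ[ℝ] ℝ :=
    (brokenInnerLeft g (β t).1.val ∘ₗ Broken.dₗ 𝒯 s - brokenInnerLeft g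
      (derivWithin (fun τ => toBroken D s (α τ)) (Ioc 0 Tend) t).1.val ∘ₗ Broken.valₗ 𝒯 s) ∘ₗ
        (Wh D s).subtype
  have hF : ∀ v, F v = brokenInner g v.1.d (β t).1.val - brokenInner g v.1.val
      (derivWithin (fun τ => toBroken D s (α τ)) (Ioc 0 Tend) t).1.val := fun v => rfl
  obtain ⟨ν, hν, huniq⟩ := PHHybrid.existsUnique_normalTrace F fun c hc => by
    have e := H.eq₁ t ht c (mem_VhVanishing_of_mem_HForm0 hΓ hc)
    rw [bdryDual_HForm0 (by omega) hc, hder] at e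
    rw [hF, e]
    ring
  refine ⟨ν, fun v => ?_, fun ν' hν' => huniq ν' fun v => ?_⟩
  · rw [hν v, hF]
    ring
  · rw [hF, hν' v]
    ring

end equivalence

end PHHybrid

end

open PHHybrid in
theorem theorem2 {n : ℕ} {M : Set (E n)} {ι : Type} [Fintype ι] (g : RiemannianMetric M)
    (𝒯 : Mesh M ι) (Dh D : FESpaces 𝒯) (Γ₁ Γ₂ : Set (E n)) (hΓ : IsBoundaryPartition M Γ₁ Γ₂)
    (r s : ℕ) (h : r + s + 1 = n) (Tend : ℝ) (hT : 0 < Tend)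
    (u₁ : ℝ → ControlSpace D Γ₁ s) (u₂ : ℝ → ControlSpace Dh Γ₂ r) :
    -- primal system
    ((∀ (α : ℝ → Wh Dh (r + 1)) (β : ℝ → Wh Dh r) (αn : ℝ → Wn Dh r) (βt : ℝ → Wt Dh r),
        IsHybridPrimal g Dh D Γ₁ Γ₂ h Tend u₁ u₂ α β αn βt ↔
          (∃ βc : ℝ → Vh Dh r, (∀ t ∈ Set.Ioc 0 Tend, toBroken Dh r (βc t) = β t) ∧
            IsMixedPrimal g Dh D Γ₁ Γ₂ h Tend u₁ u₂ α βc) ∧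
          (∀ t ∈ Set.Ioc 0 Tend, βt t = trW Dh r (β t)) ∧
          ∀ t ∈ Set.Ioc 0 Tend, HybridPrimalEq₂ g Dh Tend α β t (αn t)) ∧
      ∀ (α : ℝ → Wh Dh (r + 1)) (β : ℝ → Vh Dh r),
        IsMixedPrimal g Dh D Γ₁ Γ₂ h Tend u₁ u₂ α β →
          ∀ t ∈ Set.Ioc 0 Tend, ∃! αn : Wn Dh r,
            HybridPrimalEq₂ g Dh Tend α (fun τ => toBroken Dh r (β τ)) t αn) ∧
    -- dual system
    ((∀ (α : ℝ → Wh D s) (β : ℝ → Wh D (s + 1)) (βn : ℝ → Wn D s) (αt : ℝ → Wt D s),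
        IsHybridDual g Dh D Γ₁ Γ₂ h Tend u₁ u₂ α β βn αt ↔
          (∃ αc : ℝ → Vh D s, (∀ t ∈ Set.Ioc 0 Tend, toBroken D s (αc t) = α t) ∧
            IsMixedDual g Dh D Γ₁ Γ₂ h Tend u₁ u₂ αc β) ∧
          (∀ t ∈ Set.Ioc 0 Tend, αt t = trW D s (α t)) ∧
          ∀ t ∈ Set.Ioc 0 Tend, HybridDualEq₁ g D Tend α β t (βn t)) ∧
      ∀ (α : ℝ → Vh D s) (β : ℝ → Wh D (s + 1)),
        IsMixedDual g Dh D Γ₁ Γ₂ h Tend u₁ u₂ α β →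
          ∀ t ∈ Set.Ioc 0 Tend, ∃! βn : Wn D s,
            HybridDualEq₁ g D Tend (fun τ => toBroken D s (α τ)) β t βn) := by
  exact ⟨⟨isHybridPrimal_iff hΓ.subset_right,
      fun _ _ H _ ht => H.existsUnique_normalTrace hΓ.subset_right ht⟩,
    isHybridDual_iff hΓ.subset_left,
    fun _ _ H _ ht => H.existsUnique_normalTrace hΓ.subset_left ht⟩
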